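/- Let $F$ be a field of characteristic $0$, let $r\ge 1$, let $\pi\in\mathfrak S_r$, and let $w$ be the permutation matrix with $w_{k,b}=\delta_{b=\pi(k)}$. **Generic matrix.** Let $Inv(\pi^{-1})=\{(a,b): a<b,\ \pi^{-1}(a)>\pi^{-1}(b)\}$ and let $V_w=\{n_{a,b}:(a,b)\in Inv(\pi^{-1})\}$ be independent variables over $F$. Put $n_{a,a}=1$ and $n_{a,b}=0$ in all other cases. Let $wn$ be the matrix with entry $n_{\pi(k),b}$ in row $k$ and column $b$. Let $1_\mu$ be the entry $1$ in column $\mu$ (it is in row $\pi^{-1}(\mu)$), let $\gamma(1_\mu)$ be the rightmost nonzero entry of the row of $1_\mu$, and $\rho(1_\mu)$ the product of the nonzero entries of that row. **Path sums.** Two nonzero entries of $wn$ are neighbors if they lie in the same row or column with no nonzero entry between them. A path is a sequence of at least one nonzero entry, each of which is a neighbor of the previous one, above it or to its left; its length is the number of its entries minus $1$. For sets $A,B$ of nonzero entries with $|A|=|B|$ let $\mathcal P(A\to B)$ be the collection of sets of $|A|$ pairwise disjoint paths connecting the elements of $A$ to the elements of $B$. Let $\mathcal P_L(A\to B)$ be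 the subcollection in which every path of length at least $1$ whose origin is in the rightmost column starts by going left. Let $u(\mathbf p)$ be the product of the variables on the paths of $\mathbf p$. Put $P_L^\star(A\to B)=\sum_{\mathbf p\in\mathcal P_L(A\to B)}u(\mathbf p)$ if $|A|\geq 1$, and $P_L^\star(\emptyset\to\emptyset)=1$. **Origins and destinations.** For $n_{a,b}\in V_w$ let $D(n_{a,b})$ be the set of entries $1_\mu$ with $\mu\ge b$ and $\pi^{-1}(b)\le\pi^{-1}(\mu)\le\pi^{-1}(a)$, and let $O(n_{a,b})=\{\gamma(1_a)\}\cup\gamma(D(n_{a,b})\smallsetminus\{1_b\})$; $\gamma(1_a)$ is called the bottom origin. Let $O_1(n_{a,b})$ be the set of origins that lie in the rightmost column, above the bottom origin, and right below a variable that is not an origin of $n_{a,b}$. Let $D_1(n_{a,b})$ be the set of destinations in the rows containing an element of $O_1(n_{a,b})$. Write $\mathcal P(n_{a,b})=\mathcal P(O(n_{a,b})\to D(n_{a,b}))$ and $\mathcal P_L(n_{a,b})=\mathcal P_L(O(n_{a,b})\to D(n_{a,b}))$, and let $\mathcal P_1(n_{a,b})$ be the collection of sets in $\mathcal P(n_{a,b})\smallsetminus\mathcal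 P_L(n_{a,b})$ in which the path from the bottom origin starts by going left. Let $R$, $R_L$, $R_1$ of $n_{a,b}$ be $$(-1)^{|D(n_{a,b})|-1}\,\frac{\sum_{\mathbf p}u(\mathbf p)}{\prod_{1_\mu\in D(n_{a,b})}\rho(1_\mu)},$$ with $\mathbf p$ running over $\mathcal P(n_{a,b})$, $\mathcal P_L(n_{a,b})$, $\mathcal P_1(n_{a,b})$ respectively. Put $u_{a,b}=R(n_{a,b})$ if $n_{a,b}\in V_w$ and $u_{a,b}=n_{a,b}$ otherwise; for $k=0$ read $u_{\pi(k),b}$ as $0$. **The matrices.** Let $1\le i\le r$ with $\pi(r)<r-i+1$. For $r-i\le k\le r$, $k\ne\pi^{-1}(r)$, and $r-i+1\le b\le r-1$ put $$x'_k(b)=\begin{cases}R_L(n_{\pi(k),b})+R_1(n_{\pi(k),b})&\text{if } n_{\pi(k),b}\in V_w,\\ -n_{\pi(k),r}\,u_{\pi(k-1),b}&\text{if } u_{\pi(k),b}=0\text{ and }u_{\pi(k-1),b}\ne0,\\ u_{\pi(k),b}&\text{otherwise,}\end{cases}\qquad x^L_k(b)=\begin{cases}R_L(n_{\pi(k),b})&\text{if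 } n_{\pi(k),b}\in V_w,\\ u_{\pi(k),b}&\text{otherwise.}\end{cases}$$ Let $T'_i$ and $F'_i$ be the $(i-1)\times(i-1)$ matrices with the following rows $x'_k$ ($F'_1$ being the empty matrix). - $T'_i$: the rows with $r-i+2\le k\le r$ if $r-i+1>\pi^{-1}(r)$, and the rows with $r-i+1\le k\le r$, $k\neq\pi^{-1}(r)$, otherwise. - $F'_i$: the rows $k=r-i+1,\,r-i+3,\dots,r$ if $r-i+1>\pi^{-1}(r)$; the rows $k=r-i,\,r-i+3,\dots,r$ if $r-i+1=\pi^{-1}(r)$; and the rows $k=r-i,\,r-i+2,\dots,r$ with $k\ne\pi^{-1}(r)$ if $r-i+1<\pi^{-1}(r)$. Let $T^L_i$ and $F^L_i$ be the matrices with the rows $x^L_k$ in place of $x'_k$. The columns of all four matrices are indexed by $r-i+1,\dots,r-1$. **Column coefficients.** For $j<l$ in $\{r-i+1,\dots,r-1\}$ (so that $n_{\pi(r),j}\in V_w$) let $D_{\nearrow,l}$ be the set of elements of $D(n_{\pi(r),j})$ that are equal to $1_l$, or above and to the right of $1_l$. Let $D^{(0)}_{j,l}=D_1(n_{\pi(r),j})\cap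 D_{\nearrow,l}$. For $1\leq k\leq r$ let $D^{(2)}_{j,l,k}$ be the set of elements of $D_{\nearrow,l}\smallsetminus\{1_l\}$ in or below row $k$, and let $O^{(2)}_{j,l,k}=(\{n_{l,r}\}\cup\gamma(D^{(2)}_{j,l,k}))\smallsetminus\{n_{\pi(k),r}\}$. Put $$Q_j(l)=\sum_{1_{\pi(k)}\in D^{(0)}_{j,l}}(-1)^{|D^{(2)}_{j,l,k}|}\,n_{\pi(k),r}\,u_{\pi(k-1),j}\,\frac{P_L^\star\bigl(O^{(2)}_{j,l,k}\to D^{(2)}_{j,l,k}\bigr)}{\prod_{1_\mu\in D^{(2)}_{j,l,k}}\rho(1_\mu)}.$$ **Claim.** 1. $Q_j(l)\in\mathbb Z[n_\alpha,n_\alpha^{-1}: n_\alpha\in V_w]$ whenever $r-i+1\le j<l\le r-1$. 2. For all $r-i\le d\le r$ with $d\ne\pi^{-1}(r)$ and all $r-i+1\le j\le r-1$, with $\Sigma=\sum_{l=j+1}^{r-1}Q_j(l)\,x^L_d(l)$, we have $$x'_d(j)+\Sigma=x^L_d(j).$$ In more detail: - (type 1) if $d\le\max(\pi^{-1}(j),\pi^{-1}(r)-1)$,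 then $x'_d(j)=x^L_d(j)=u_{\pi(d),j}$ and $\Sigma=0$; - (type 2) if $d>\max(\pi^{-1}(j),\pi^{-1}(r))$ and $\pi(d)<j$, then $x'_d(j)=R_L(n_{\pi(d),j})+R_1(n_{\pi(d),j})$, $x^L_d(j)=R_L(n_{\pi(d),j})$ and $R_1(n_{\pi(d),j})+\Sigma=0$; - (type 3) if $d>\max(\pi^{-1}(j),\pi^{-1}(r))$ and $\pi(d-1)\le j<\pi(d)$, then $x'_d(j)=-n_{\pi(d),r}u_{\pi(d-1),j}$, $x^L_d(j)=0$ and $-n_{\pi(d),r}u_{\pi(d-1),j}+\Sigma=0$; - (type 4) if $d>\max(\pi^{-1}(j),\pi^{-1}(r))$ and $j<\min(\pi(d-1),\pi(d))$, then $x'_d(j)=x^L_d(j)=0$ and $\Sigma=0$. 3. There is a lower triangular matrix $M_{\rm col}$ with ones on the diagonal and entries in $\mathbb Z[n_\alpha,n_\alpha^{-1}: n_\alpha\in V_w]$ such that $T'_iM_{\rm col}=T^L_i$ and $F'_iM_{\rm col}=F^L_i$. It represents the column operations with coefficients $Q_j(l)$: $M_{\rm col}\,(I-\mathcal Q)=I$,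 where $\mathcal Q$ is the strictly lower triangular matrix with entry $Q_j(l)$ in the row of $l$ and the column of $j$ for $j<l$. -/

import Mathlib

/-!
Conventions.  The size of the matrices is `r = m + 1`, and rows and columns are indexed by
`Fin (m + 1)`, that is, from `0` to `m`; the (zero-based) index `k` stands for the `(k + 1)`-st row
or column.  In particular `Fin.last m` is the last (the `r`-th) row or column.
The permutation `π` is the one of the permutation matrix `w` with `w k b = 1` iff `b = π k`.
Sets of entries `1_μ` are given as sets of their column indices `μ`; sets of general entries of the
matrix `w n` are given as sets of positions (row, column).
-/

namespace ColOp

open Finset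

noncomputable section

/-! ### The generic matrix `w n` -/

section Combinatorics

variable {m : ℕ} (π : Equiv.Perm (Fin (m + 1)))

/-- `Inv(π⁻¹)`: the set of indices `(a, b)` of the free variables `n_{a,b}`. -/
def Inv : Set (Fin (m + 1) × Fin (m + 1)) :=
  {α | α.1 < α.2 ∧ π.symm α.2 < π.symm α.1}

/-- A position (row, column) in the matrix `w n`. -/
abbrev Cell (m : ℕ) : Type := Fin (m + 1) × Fin (m + 1)

/-- The position holds a free variable; the entry of `w n` in row `k`, column `b` is
`n_{π(k),b}`. -/
def IsFree (c : Cell m) : Prop := (π c.1, c.2) ∈ Inv π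

/-- The entry of `w n` at the position is nonzero: it is an entry `1` or a free variable. -/
def IsNz (c : Cell m) : Prop := π c.1 = c.2 ∨ IsFree π c

/-! ### Paths -/

/-- One step of a path: from a nonzero entry to the neighbouring nonzero entry above it (same
column, no nonzero entry in between) or to its left (same row, no nonzero entry in between). -/
def Step (c c' : Cell m) : Prop :=
  IsNz π c ∧ IsNz π c' ∧
    ((c'.2 = c.2 ∧ c'.1 < c.1 ∧ ∀ k, c'.1 < k → k < c.1 → ¬ IsNz π (k, c.2)) ∨
      (c'.1 = c.1 ∧ c'.2 < c.2 ∧ ∀ b, c'.2 < b → b < c.2 → ¬ IsNz π (c.1, b)))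

/-- A path: a nonempty sequence of nonzero entries, each obtained from the previous one by a step
upwards or to the left.  Paths of length `0` (one entry) are allowed. -/
def IsPath (p : List (Cell m)) : Prop :=
  p ≠ [] ∧ (∀ c ∈ p, IsNz π c) ∧ p.IsChain (Step π)

/-- The type of paths in `w n`. -/
abbrev Path : Type := {p : List (Cell m) // IsPath π p}

theorem Step.lt {c c' : Cell m} (h : Step π c c') : c' < c := by
  rcases h with ⟨-, -, ⟨h1, h2, -⟩ | ⟨h1, h2, -⟩⟩
  · exact Prod.lt_iff.2 (Or.inl ⟨h2, h1.le⟩)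
  · exact Prod.lt_iff.2 (Or.inr ⟨h1.le, h2⟩)

theorem IsPath.nodup {p : List (Cell m)} (h : IsPath π p) : p.Nodup := by
  have h1 : p.IsChain (fun a b => b < a) := h.2.2.imp fun _ _ h => Step.lt π h
  have : IsTrans (Cell m) (fun a b => b < a) := ⟨fun _ _ _ h1 h2 => h2.trans h1⟩
  exact (List.isChain_iff_pairwise.1 h1).imp fun h => ne_of_gt h

instance : Fintype (Path π) :=
  Fintype.ofInjective
    (fun p => (⟨p.1, IsPath.nodup π p.2⟩ : {l : List (Cell m) // l.Nodup}))
    (fun p q h => Subtype.ext (by simpa using h))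

variable {π}

/-- The first entry of a path. -/
def Path.origin (p : Path π) : Cell m := p.1.head p.2.1

/-- The last entry of a path. -/
def Path.dest (p : Path π) : Cell m := p.1.getLast p.2.1

/-- The path has length at least one and its first step goes to the left. -/
def Path.StartsLeft (p : Path π) : Prop :=
  ∃ c c' l, p.1 = c :: c' :: l ∧ c'.1 = c.1

/-- The path has length at least one. -/
def Path.Nontrivial (p : Path π) : Prop := 1 ≤ p.1.length - 1

variable (π)

open Classical in
/-- `𝒫(A → B)`: the collection of the sets of pairwise disjoint paths that connect the elements of
`A` to the elements of `B`. -/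
def paths (A B : Finset (Cell m)) : Finset (Finset (Path π)) :=
  univ.filter fun P =>
    P.image Path.origin = A ∧ P.image Path.dest = B ∧
      ∀ p ∈ P, ∀ q ∈ P, p ≠ q → ∀ c ∈ p.1, c ∉ q.1

open Classical in
/-- `𝒫_L(A → B)`: every path of length at least one whose origin lies in the rightmost column
starts by going left. -/
def pathsL (A B : Finset (Cell m)) : Finset (Finset (Path π)) :=
  (paths π A B).filter fun P =>
    ∀ p ∈ P, p.Nontrivial → p.origin.2 = Fin.last m → p.StartsLeft

/-! ### Origins and destinations -/

/-- The position of the entry `1_μ`, the entry `1` of column `μ`. -/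
def one (μ : Fin (m + 1)) : Cell m := (π.symm μ, μ)

open Classical in
/-- The columns of the nonzero entries of row `k`. -/
def rowSupport (k : Fin (m + 1)) : Finset (Fin (m + 1)) := univ.filter fun b => IsNz π (k, b)

theorem rowSupport_nonempty (k : Fin (m + 1)) : (rowSupport π k).Nonempty :=
  ⟨π k, by classical exact mem_filter.2 ⟨mem_univ _, Or.inl rfl⟩⟩

/-- `γ(1_μ)`: the rightmost nonzero entry of the row containing `1_μ`. -/
def gam (μ : Fin (m + 1)) : Cell m :=
  (π.symm μ, (rowSupport π (π.symm μ)).max' (rowSupport_nonempty π _))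

/-- `D(n_{a,b})`: the entries `1_μ` in the submatrix of `w n` with rows `π⁻¹(b), …, π⁻¹(a)` and
columns `b, …, r`. -/
def dests (a b : Fin (m + 1)) : Finset (Fin (m + 1)) :=
  univ.filter fun μ => b ≤ μ ∧ π.symm b ≤ π.symm μ ∧ π.symm μ ≤ π.symm a

/-- `O(n_{a,b})`: the rightmost nonzero entry of the bottom row of that submatrix (the row of
`1_a`), and the rightmost nonzero entries of the rows of the destinations other than `1_b`. -/
def origins (a b : Fin (m + 1)) : Finset (Cell m) :=
  insert (gam π a) (((dests π a b).erase b).image (gam π))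

open Classical in
/-- `O_1(n_{a,b})`: the origins in the rightmost column, above the bottom origin and right below a
free variable that is not an origin of `n_{a,b}`. -/
def origins1 (a b : Fin (m + 1)) : Finset (Cell m) :=
  (origins π a b).filter fun c =>
    c.2 = Fin.last m ∧ c.1 < π.symm a ∧
      ∃ k : Fin (m + 1), (k : ℕ) + 1 = c.1 ∧ IsFree π (k, Fin.last m) ∧
        (k, Fin.last m) ∉ origins π a b

open Classical in
/-- `D_1(n_{a,b})`: the destinations in the rows that contain an element of `O_1(n_{a,b})`. -/
def dests1 (a b : Fin (m + 1)) : Finset (Fin (m + 1)) :=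
  (dests π a b).filter fun μ => ∃ c ∈ origins1 π a b, c.1 = π.symm μ

/-- `D_{↓,k}(n_{a,b})`: the destinations in or below row `k`. -/
def destsDown (k a b : Fin (m + 1)) : Finset (Fin (m + 1)) :=
  (dests π a b).filter fun μ => k ≤ π.symm μ

/-- `D_{↗,l}(n_{a,b})`: the destinations equal to `1_l`, or above and to the right of `1_l`. -/
def destsNE (l a b : Fin (m + 1)) : Finset (Fin (m + 1)) :=
  (dests π a b).filter fun μ => μ = l ∨ (π.symm μ < π.symm l ∧ l < μ)

open Classical in
/-- `𝒫_1(n_{a,b})`: the sets in `𝒫(n_{a,b}) ∖ 𝒫_L(n_{a,b})` in which the path from the bottom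
origin starts by going left. -/
def paths1 (a b : Fin (m + 1)) : Finset (Finset (Path π)) :=
  (paths π (origins π a b) ((dests π a b).image (one π)) \
      pathsL π (origins π a b) ((dests π a b).image (one π))).filter
    fun P => ∃ p ∈ P, p.origin = gam π a ∧ p.StartsLeft

/-- `D^{(0)}_{j,l}`. -/
def D0 (j l : Fin (m + 1)) : Finset (Fin (m + 1)) :=
  dests1 π (π (Fin.last m)) j ∩ destsNE π l (π (Fin.last m)) j

/-- `D^{(2)}_{j,l,k}`. -/
def D2 (j l k : Fin (m + 1)) : Finset (Fin (m + 1)) :=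
  (destsNE π l (π (Fin.last m)) j).erase l ∩ destsDown π k (π (Fin.last m)) j

/-- `O^{(2)}_{j,l,k} = ({n_{l,r}} ∪ γ(D^{(2)}_{j,l,k})) ∖ {n_{π(k),r}}`. -/
def O2 (j l k : Fin (m + 1)) : Finset (Cell m) :=
  (insert (π.symm l, Fin.last m) ((D2 π j l k).image (gam π))).erase (k, Fin.last m)

end Combinatorics

/-! ### Rational functions -/

section Functions

variable (F : Type*) [Field F] {m : ℕ} (π : Equiv.Perm (Fin (m + 1)))

/-- The field of rational functions over `F` in the free variables `n_{a,b}`,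
`(a, b) ∈ Inv(π⁻¹)`. -/
abbrev RatFun : Type _ := FractionRing (MvPolynomial (Inv π) F)

open Classical in
/-- The entry `n_{a,b}` of the generic unipotent matrix `n`: a free variable, `1` or `0`. -/
def nvar (a b : Fin (m + 1)) : RatFun F π :=
  if h : (a, b) ∈ Inv π then
    algebraMap (MvPolynomial (Inv π) F) (RatFun F π) (MvPolynomial.X ⟨(a, b), h⟩)
  else if a = b then 1 else 0

/-- The ring `ℤ[n_α, n_α⁻¹]` of Laurent polynomials with integer coefficients in the free
variables. -/
def laurent : Subring (RatFun F π) :=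
  Subring.closure {x | ∃ α ∈ Inv π, x = nvar F π α.1 α.2 ∨ x = (nvar F π α.1 α.2)⁻¹}

/-- The matrix `w n`. -/
def wn : Matrix (Fin (m + 1)) (Fin (m + 1)) (RatFun F π) := Matrix.of fun k b => nvar F π (π k) b

variable {π} in
/-- `u(𝐩)`: the product of all free variables traversed by the paths (entries `1` contribute the
factor `1`). -/
def weight (P : Finset (Path π)) : RatFun F π :=
  ∏ p ∈ P, (p.1.map fun c => wn F π c.1 c.2).prod

/-- `P_L(A → B)`. -/
def PL (A B : Finset (Cell m)) : RatFun F π := ∑ P ∈ pathsL π A B, weight F P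

/-- `P_L^⋆(A → B)`. -/
def PLstar (A B : Finset (Cell m)) : RatFun F π := if A = ∅ ∧ B = ∅ then 1 else PL F π A B

/-- `ρ(1_μ)`: the product of the nonzero entries in the row of `1_μ`. -/
def rho (μ : Fin (m + 1)) : RatFun F π :=
  ∏ b ∈ rowSupport π (π.symm μ), wn F π (π.symm μ) b

/-- The common shape `(-1)^{|D| - 1} S / ∏_{1_μ ∈ D} ρ(1_μ)`, `D = D(n_{a,b})`, of `R`, `R_L` and
`R_1`, where `S` is the sum of the weights over a collection of sets of paths. -/
def Rgen (C : Finset (Finset (Path π))) (a b : Fin (m + 1)) : RatFun F π :=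
  (-1) ^ ((dests π a b).card - 1) * (∑ P ∈ C, weight F P) / ∏ μ ∈ dests π a b, rho F π μ

/-- `R(n_{a,b})`, with path sum over `𝒫(n_{a,b}) = 𝒫(O(n_{a,b}) → D(n_{a,b}))`. -/
def R (a b : Fin (m + 1)) : RatFun F π :=
  Rgen F π (paths π (origins π a b) ((dests π a b).image (one π))) a b

/-- `R_L(n_{a,b})`, with path sum over `𝒫_L(n_{a,b})`. -/
def RL (a b : Fin (m + 1)) : RatFun F π :=
  Rgen F π (pathsL π (origins π a b) ((dests π a b).image (one π))) a b

/-- `R_1(n_{a,b})`, with path sum over `𝒫_1(n_{a,b})`. -/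
def R1 (a b : Fin (m + 1)) : RatFun F π := Rgen F π (paths1 π a b) a b

open Classical in
/-- The matrix `w u`, obtained from `w n` by replacing each free variable `n_α` by
`u_α = R(n_α)`; its entry in row `k`, column `b` is `u_{π(k),b}`. -/
def wu : Matrix (Fin (m + 1)) (Fin (m + 1)) (RatFun F π) :=
  Matrix.of fun k b => if IsFree π (k, b) then R F π (π k) b else wn F π k b

/-- `u_{π(k-1),b}`: the entry of `w u` right above row `k`, column `b` (`0` if `k` is the top
row). -/
def wuAbove (k b : Fin (m + 1)) : RatFun F π :=
  if h : (k : ℕ) = 0 then 0 else wu F π ⟨(k : ℕ) - 1, by omega⟩ b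

open Classical in
/-- The entry `x'_k(b)`. -/
def xPrime (k b : Fin (m + 1)) : RatFun F π :=
  if IsFree π (k, b) then RL F π (π k) b + R1 F π (π k) b
  else if wu F π k b = 0 ∧ wuAbove F π k b ≠ 0 then
    -nvar F π (π k) (Fin.last m) * wuAbove F π k b
  else wu F π k b

open Classical in
/-- The entry `x^L_k(b)`. -/
def xL (k b : Fin (m + 1)) : RatFun F π :=
  if IsFree π (k, b) then RL F π (π k) b else wu F π k b

/-- The column coefficient `Q_j(l)`: a sum over the entries `1_ν = 1_{π(k)}` in `D^{(0)}_{j,l}`,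
where `k = π⁻¹(ν)` is the row of `1_ν`. -/
def Q (j l : Fin (m + 1)) : RatFun F π :=
  ∑ ν ∈ D0 π j l,
    (-1) ^ (D2 π j l (π.symm ν)).card * nvar F π ν (Fin.last m) * wuAbove F π (π.symm ν) j *
      (PLstar F π (O2 π j l (π.symm ν)) ((D2 π j l (π.symm ν)).image (one π)) /
        ∏ μ ∈ D2 π j l (π.symm ν), rho F π μ)

end Functions

/-! ### The matrices `T'_i`, `F'_i`, `T^L_i`, `F^L_i` -/

section Matrices

/-- The `q`-th column of `T'_i`, `F'_i`, `T^L_i`, `F^L_i` comes from column `r - i + q`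
(zero-based), where `r = m + 1`. -/
def col (m i : ℕ) (q : Fin (i - 1)) : Fin (m + 1) := Fin.ofNat (m + 1) (m + 1 - i + q)

variable {m : ℕ} (π : Equiv.Perm (Fin (m + 1)))

/-- The row index of `1_r`, that is `π⁻¹(r)` (zero-based). -/
def rowOne : ℕ := (π.symm (Fin.last m) : ℕ)

/-- The rows of `T'_i` and `T^L_i` (zero-based).  If `1_r` is above the `i` bottom rows, these are
the `i` bottom rows without the first of them; otherwise the `i` bottom rows without the row of
`1_r`. -/
def rowT (i : ℕ) (p : Fin (i - 1)) : Fin (m + 1) :=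
  Fin.ofNat (m + 1)
    (if rowOne π < m + 1 - i then m + 1 - i + 1 + p
      else if m + 1 - i + p < rowOne π then m + 1 - i + p else m + 1 - i + p + 1)

/-- The rows of `F'_i` and `F^L_i` (zero-based).  With one-based indices, these are
`r-i+1, r-i+3, …, r` if `r-i+1 > π⁻¹(r)`; `r-i, r-i+3, …, r` if `r-i+1 = π⁻¹(r)`; and
`r-i, r-i+2, …, r` without `π⁻¹(r)` if `r-i+1 < π⁻¹(r)`. -/
def rowF (i : ℕ) (p : Fin (i - 1)) : Fin (m + 1) :=
  Fin.ofNat (m + 1)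
    (if rowOne π < m + 1 - i then
        (if (p : ℕ) = 0 then m + 1 - i else m + 1 - i + 1 + p)
      else if rowOne π = m + 1 - i then
        (if (p : ℕ) = 0 then m + 1 - i - 1 else m + 1 - i + 1 + p)
      else
        (if (p : ℕ) = 0 then m + 1 - i - 1
          else if m + 1 - i + p < rowOne π then m + 1 - i + p else m + 1 - i + p + 1))

variable (F : Type*) [Field F]

/-- The matrix `T'_i`. -/
def TPrime (i : ℕ) : Matrix (Fin (i - 1)) (Fin (i - 1)) (RatFun F π) :=
  Matrix.of fun p q => xPrime F π (rowT π i p) (col m i q)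

/-- The matrix `F'_i`. -/
def FPrime (i : ℕ) : Matrix (Fin (i - 1)) (Fin (i - 1)) (RatFun F π) :=
  Matrix.of fun p q => xPrime F π (rowF π i p) (col m i q)

/-- The matrix `T^L_i`. -/
def TL (i : ℕ) : Matrix (Fin (i - 1)) (Fin (i - 1)) (RatFun F π) :=
  Matrix.of fun p q => xL F π (rowT π i p) (col m i q)

/-- The matrix `F^L_i`. -/
def FL (i : ℕ) : Matrix (Fin (i - 1)) (Fin (i - 1)) (RatFun F π) :=
  Matrix.of fun p q => xL F π (rowF π i p) (col m i q)

/-- The strictly lower triangular matrix of the column coefficients: its entry in the row of `l` and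
the column of `j` is `Q_j(l)` for `j < l`. -/
def Qmat (i : ℕ) : Matrix (Fin (i - 1)) (Fin (i - 1)) (RatFun F π) :=
  Matrix.of fun p q => if q < p then Q F π (col m i q) (col m i p) else 0

end Matrices

end

end ColOp

/-! All path sums are written as `pathSum`, a weighted sum over systems of disjoint paths whose
steps lie in a prescribed relation. The relation `StepCut π t` forbids upward steps in the rightmost
column that start in rows `≥ t`. For `t = 0` this is the condition defining `𝒫_L` (`pathsL_eq`), for
`t = m + 1` there is no restriction (`paths_eq`), and for the entry in row `d` below `1_r` the cut
`t = d` gives `𝒫_L` together with `𝒫_1` (`sum_paths1`).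

Raising the cut from `k` to `k + 1` adds exactly the systems whose path from the rightmost cell of
row `k` starts upwards, onto a cell that is not an origin. This happens only for `k` in `jumpRows`.
Such a system splits at row `k` into an unrestricted system above it, with sum `u_{π(k-1),j}` up to
normalization, and a left-starting system below it. Telescoping over `k < d` yields `R1_eq`: `R_1`
is the sum of `jumpCoeff j k * leftSum (j + 1) k d`. The rows of `D_1` are the same `jumpRows`, so
`Q_j(l)` is the sum over `k` of `jumpCoeff j k * leftSum (l + 1) k (π⁻¹ l)` (`Q_eq`), while for `l =
π e` with `e < d` and `π d < l` the entry `x^L_d(l)` is `-leftSum l e d` (`xL_eq_leftSum`).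

What remains is a composition law for `leftSum`, namely `leftSum_eq_sum`. It is obtained one column
at a time from `leftSum_succ`, the normalized form of the exchange identity `pathSum_exchange`; that
identity is proved by moving one origin along its path with `pathSum_rec`. The law evaluates the sum
over `l` attached to a fixed row `k`: it is `-leftSum (j + 1) k d` (or `0` if `k ≥ d`) when `π d <
j`, and the Kronecker delta of `k` and `d` when `j < π d`. The first value cancels `R_1`, the second
cancels `-n_{π(d),r} u_{π(d-1),j}`.

In matrix form the identities say `X' = X^L (1 - 𝒬)`, and `1 - 𝒬` is unitriangular over the Laurent
ring. -/

namespace ColOp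

open Finset

noncomputable section

/-! ### Sums over path systems with restricted steps -/

section PathSystems

open scoped Classical

variable {m : ℕ} {π : Equiv.Perm (Fin (m + 1))}

/-- The systems of disjoint paths from `A` to `B` all of whose steps satisfy `r`. -/
def pathsRel (π : Equiv.Perm (Fin (m + 1))) (r : Cell m → Cell m → Prop) (A B : Finset (Cell m)) :
    Finset (Finset (Path π)) :=
  (paths π A B).filter fun P => ∀ p ∈ P, p.1.IsChain r

/-- The weight of a single path. -/
def pathWeight (F : Type*) [Field F] (p : Path π) : RatFun F π :=
  (p.1.map fun c => wn F π c.1 c.2).prod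

/-- The weighted sum over the path systems from `A` to `B` with steps in `r`. -/
def pathSum (F : Type*) [Field F] (π : Equiv.Perm (Fin (m + 1))) (r : Cell m → Cell m → Prop)
    (A B : Finset (Cell m)) : RatFun F π :=
  ∑ P ∈ pathsRel π r A B, weight F P

theorem mem_pathsRel {r : Cell m → Cell m → Prop} {A B : Finset (Cell m)} {P : Finset (Path π)} :
    P ∈ pathsRel π r A B ↔ P.image Path.origin = A ∧ P.image Path.dest = B ∧
      (∀ p ∈ P, ∀ q ∈ P, p ≠ q → ∀ c ∈ p.1, c ∉ q.1) ∧ ∀ p ∈ P, p.1.IsChain r := by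
  simp only [pathsRel, paths, mem_filter, mem_univ, true_and, and_assoc]

theorem Path.origin_mem (p : Path π) : p.origin ∈ p.1 := List.head_mem _

theorem Path.dest_mem (p : Path π) : p.dest ∈ p.1 := List.getLast_mem _

theorem reflTransGen_of_isChain {α : Type*} {r : α → α → Prop} {l : List α} (hl : l.IsChain r)
    (hne : l ≠ []) : ∀ x ∈ l, Relation.ReflTransGen r (l.head hne) x := by
  induction l with
  | nil => simp
  | cons a l ih =>
    intro x hx
    rcases List.mem_cons.1 hx with rfl | hx
    · exact .refl
    · have hne' : l ≠ [] := List.ne_nil_of_mem hx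
      obtain ⟨b, l', rfl⟩ := List.exists_cons_of_ne_nil hne'
      have h := List.isChain_cons_cons.1 hl
      exact (Relation.ReflTransGen.single h.1).trans (ih h.2 hne' x hx)

theorem reflTransGen_getLast_of_isChain {α : Type*} {r : α → α → Prop} {l : List α}
    (hl : l.IsChain r) (hne : l ≠ []) :
    ∀ x ∈ l, Relation.ReflTransGen r x (l.getLast hne) := by
  induction l with
  | nil => simp
  | cons a l ih =>
    intro x hx
    rcases l with _ | ⟨b, l⟩
    · simp only [List.mem_singleton] at hx
      subst hx
      exact .refl
    · have h := List.isChain_cons_cons.1 hl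
      rw [List.getLast_cons (by simp)]
      rcases List.mem_cons.1 hx with rfl | hx
      · exact (Relation.ReflTransGen.single h.1).trans (ih h.2 (by simp) b (by simp))
      · exact ih h.2 (by simp) x hx

theorem reflTransGen_le {r : Cell m → Cell m → Prop} (hr : ∀ x y, r x y → Step π x y)
    {x y : Cell m} (h : Relation.ReflTransGen r x y) : y ≤ x := by
  induction h with
  | refl => exact le_rfl
  | tail _ h ih => exact (Step.lt π (hr _ _ h)).le.trans ih

theorem Path.reach {r : Cell m → Cell m → Prop} {p : Path π} (hp : p.1.IsChain r) {x : Cell m}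
    (hx : x ∈ p.1) : Relation.ReflTransGen r p.origin x :=
  reflTransGen_of_isChain hp p.2.1 x hx

theorem Path.reach_dest {r : Cell m → Cell m → Prop} {p : Path π} (hp : p.1.IsChain r) {x : Cell m}
    (hx : x ∈ p.1) : Relation.ReflTransGen r x p.dest :=
  reflTransGen_getLast_of_isChain hp p.2.1 x hx

theorem Path.dest_le {p : Path π} {x : Cell m} (hx : x ∈ p.1) : p.dest ≤ x :=
  reflTransGen_le (fun _ _ h => h) (Path.reach_dest p.2.2.2 hx)

theorem eq_of_disjoint {P : Finset (Path π)}
    (h : ∀ p ∈ P, ∀ q ∈ P, p ≠ q → ∀ c ∈ p.1, c ∉ q.1) {p q : Path π} (hp : p ∈ P) (hq : q ∈ P)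
    {c : Cell m} (hcp : c ∈ p.1) (hcq : c ∈ q.1) : p = q := by
  by_contra hne
  exact h p hp q hq hne c hcp hcq

theorem image_erase_of_disjoint {P : Finset (Path π)} {f : Path π → Cell m}
    (hf : ∀ p, f p ∈ p.1) (h : ∀ p ∈ P, ∀ q ∈ P, p ≠ q → ∀ c ∈ p.1, c ∉ q.1) {p : Path π}
    (hp : p ∈ P) : (P.erase p).image f = (P.image f).erase (f p) := by
  ext x
  simp only [mem_image, mem_erase]
  constructor
  · rintro ⟨q, ⟨hqp, hq⟩, rfl⟩
    refine ⟨fun hx => hqp ?_, q, hq, rfl⟩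
    exact eq_of_disjoint h hq hp (hf q) (hx ▸ hf p)
  · rintro ⟨hx, q, hq, rfl⟩
    exact ⟨q, ⟨fun hqp => hx (by rw [hqp]), hq⟩, rfl⟩

variable (F : Type*) [Field F]

/-- Systems are sorted by their path through the origin `c`. Disjointness makes that path unique,
and deleting it is a bijection onto the smaller systems that avoid it. -/
theorem pathSum_pop {r : Cell m → Cell m → Prop} {A B : Finset (Cell m)} {c : Cell m}
    (hc : c ∈ A) :
    pathSum F π r A B =
      ∑ p ∈ univ.filter (fun p : Path π => p.origin = c ∧ p.1.IsChain r ∧ p.dest ∈ B),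
        pathWeight F p * ∑ P ∈ (pathsRel π r (A.erase c) (B.erase p.dest)).filter
          (fun P => ∀ q ∈ P, ∀ x ∈ p.1, x ∉ q.1), weight F P := by
  have h1 : ∀ p ∈ univ.filter (fun p : Path π => p.origin = c ∧ p.1.IsChain r ∧ p.dest ∈ B),
      pathWeight F p * ∑ P ∈ (pathsRel π r (A.erase c) (B.erase p.dest)).filter
          (fun P => ∀ q ∈ P, ∀ x ∈ p.1, x ∉ q.1), weight F P =
      ∑ P ∈ (pathsRel π r A B).filter (fun P => p ∈ P), weight F P := by
    intro p hp
    obtain ⟨hpc, hpr, hpB⟩ := (mem_filter.1 hp).2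
    rw [mul_sum]
    have hnot : ∀ P ∈ (pathsRel π r (A.erase c) (B.erase p.dest)).filter
          (fun P => ∀ q ∈ P, ∀ x ∈ p.1, x ∉ q.1), p ∉ P := by
      intro P hP hpP
      exact (mem_filter.1 hP).2 p hpP _ p.origin_mem p.origin_mem
    refine sum_bij' (fun P _ => insert p P) (fun P _ => P.erase p) ?_ ?_ ?_ ?_ ?_
    · intro P hP
      obtain ⟨hP1, hP2⟩ := mem_filter.1 hP
      obtain ⟨hA, hB, hd, hch⟩ := mem_pathsRel.1 hP1
      refine mem_filter.2 ⟨mem_pathsRel.2 ⟨?_, ?_, ?_, ?_⟩, mem_insert_self _ _⟩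
      · rw [image_insert, hA, hpc, insert_erase hc]
      · rw [image_insert, hB, insert_erase hpB]
      · intro q hq q' hq' hne x hx hx'
        rcases mem_insert.1 hq with rfl | hq <;> rcases mem_insert.1 hq' with rfl | hq'
        · exact hne rfl
        · exact hP2 q' hq' x hx hx'
        · exact hP2 _ (by assumption) x hx' hx
        · exact hd q hq q' hq' hne x hx hx'
      · intro q hq
        rcases mem_insert.1 hq with rfl | hq
        · exact hpr
        · exact hch q hq
    · intro P hP
      obtain ⟨hP1, hpP⟩ := mem_filter.1 hP
      obtain ⟨hA, hB, hd, hch⟩ := mem_pathsRel.1 hP1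
      refine mem_filter.2 ⟨mem_pathsRel.2 ⟨?_, ?_, ?_, ?_⟩, ?_⟩
      · rw [image_erase_of_disjoint Path.origin_mem hd hpP, hA, hpc]
      · rw [image_erase_of_disjoint Path.dest_mem hd hpP, hB]
      · exact fun q hq q' hq' => hd q (mem_of_mem_erase hq) q' (mem_of_mem_erase hq')
      · exact fun q hq => hch q (mem_of_mem_erase hq)
      · intro q hq x hx hxq
        exact hd p hpP q (mem_of_mem_erase hq) (ne_of_mem_erase hq).symm x hx hxq
    · intro P hP
      exact erase_insert (hnot P hP)
    · intro P hP
      exact insert_erase (mem_filter.1 hP).2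
    · intro P hP
      rw [weight, weight, prod_insert (hnot P hP)]
      rfl
  rw [sum_congr rfl h1, pathSum]
  simp_rw [sum_filter (s := pathsRel π r A B)]
  rw [sum_comm]
  refine sum_congr rfl fun P hP => ?_
  obtain ⟨hA, hB, hd, hch⟩ := mem_pathsRel.1 hP
  obtain ⟨p, hp, hpc⟩ := mem_image.1 (hA ▸ hc)
  rw [sum_eq_single p]
  · rw [if_pos hp]
  · intro q hq hqp
    rw [if_neg]
    intro hqP
    exact hqp (eq_of_disjoint hd hqP hp q.origin_mem
      (by rw [(mem_filter.1 hq).2.1, ← hpc]; exact p.origin_mem))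
  · intro hp'
    exact (hp' (mem_filter.2 ⟨mem_univ _, hpc, hch p hp, hB ▸ mem_image_of_mem _ hp⟩)).elim

/-- The path obtained by adding an entry at the beginning. -/
def Path.cons (c : Cell m) (q : Path π) (h : Step π c q.origin) : Path π :=
  ⟨c :: q.1, by simp, by
    intro x hx
    rcases List.mem_cons.1 hx with rfl | hx
    · exact h.1
    · exact q.2.2.1 x hx, by
    obtain ⟨l, hl⟩ := q
    obtain ⟨a, l, rfl⟩ := List.exists_cons_of_ne_nil hl.1
    exact List.isChain_cons_cons.2 ⟨h, hl.2.2⟩⟩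

theorem Path.dest_cons (c : Cell m) (q : Path π) (h : Step π c q.origin) :
    (Path.cons c q h).dest = q.dest := by
  simp only [Path.dest, Path.cons]
  exact List.getLast_cons q.2.1

theorem Path.isChain_cons {r : Cell m → Cell m → Prop} (c : Cell m) (q : Path π)
    (h : Step π c q.origin) : (Path.cons c q h).1.IsChain r ↔ r c q.origin ∧ q.1.IsChain r := by
  obtain ⟨l, hl⟩ := q
  obtain ⟨a, l, rfl⟩ := List.exists_cons_of_ne_nil hl.1
  exact List.isChain_cons_cons

theorem wn_eq_zero {c : Cell m} (hc : ¬ IsNz π c) : wn F π c.1 c.2 = 0 := by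
  simp only [IsNz, IsFree, not_or] at hc
  simp [wn, nvar, hc.1, hc.2]

theorem Path.eq_singleton_or_cons (p : Path π) :
    p.1 = [p.origin] ∨ ∃ (q : Path π) (h : Step π p.origin q.origin),
      p = Path.cons p.origin q h := by
  obtain ⟨l, hl⟩ := p
  rcases l with _ | ⟨a, _ | ⟨b, l⟩⟩
  · exact (hl.1 rfl).elim
  · left; rfl
  · right
    have h := List.isChain_cons_cons.1 hl.2.2
    exact ⟨⟨b :: l, by simp, fun x hx => hl.2.1 x (List.mem_cons_of_mem _ hx), h.2⟩, h.1, rfl⟩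

/-- The path from `c` either stops at once or takes a first step. By `hun` no other path can pass
through `c`, so cutting `c` off loses no disjointness condition. A step onto another origin would
meet the path starting there, hence the restriction `c' ∉ A`. -/
theorem pathSum_rec {r : Cell m → Cell m → Prop} (hrs : ∀ x y, r x y → Step π x y)
    {A B : Finset (Cell m)} {c : Cell m} (hc : c ∈ A)
    (hun : ∀ a ∈ A, a ≠ c → ¬ Relation.ReflTransGen r a c) :
    pathSum F π r A B =
      (if c ∈ B then wn F π c.1 c.2 * pathSum F π r (A.erase c) (B.erase c) else 0) +
        ∑ c' ∈ univ.filter (fun c' => r c c' ∧ c' ∉ A),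
          wn F π c.1 c.2 * pathSum F π r (insert c' (A.erase c)) B := by
  -- At a zero entry both sides vanish: no path starts there, and the factor `wn F π c.1 c.2` is
  -- zero.
  by_cases hnz : IsNz π c
  swap
  · simp only [wn_eq_zero F hnz, zero_mul, ite_self, sum_const_zero, add_zero]
    rw [pathSum_pop F hc]
    refine sum_eq_zero fun p hp => ?_
    have := (mem_filter.1 hp).2.1
    exact (hnz (this ▸ p.2.2.1 _ p.origin_mem)).elim
  rw [pathSum_pop F hc]
  have hun' : ∀ D, ∀ P ∈ pathsRel π r (A.erase c) D, ∀ q ∈ P, c ∉ q.1 := by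
    intro D P hP q hq hcq
    obtain ⟨hA, hB, hd, hch⟩ := mem_pathsRel.1 hP
    have h1 : q.origin ∈ A.erase c := hA ▸ mem_image_of_mem _ hq
    exact hun _ (mem_of_mem_erase h1) (ne_of_mem_erase h1) (Path.reach (hch q hq) hcq)
  set G : Path π → RatFun F π := fun p => pathWeight F p *
    ∑ P ∈ (pathsRel π r (A.erase c) (B.erase p.dest)).filter
      (fun P => ∀ q ∈ P, ∀ x ∈ p.1, x ∉ q.1), weight F P with hG
  set p0 : Path π := ⟨[c], by simp, by simpa using hnz, by simp⟩ with hp0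
  rw [← sum_filter_add_sum_filter_not _ (fun p : Path π => p = p0)]
  congr 1
  · rw [filter_filter]
    split_ifs with hcB
    · have : (univ.filter fun p : Path π =>
          (p.origin = c ∧ p.1.IsChain r ∧ p.dest ∈ B) ∧ p = p0) = {p0} := by
        ext p
        simp only [mem_filter, mem_univ, true_and, mem_singleton]
        constructor
        · exact fun h => h.2
        · rintro rfl
          exact ⟨⟨rfl, by simp [hp0], hcB⟩, rfl⟩
      rw [this, sum_singleton]
      have h2 : pathWeight F p0 = wn F π c.1 c.2 := by simp [pathWeight, hp0]
      simp only [h2]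
      congr 1
      rw [pathSum]
      have h3 : p0.dest = c := rfl
      rw [h3]
      refine sum_congr (filter_true_of_mem ?_) fun _ _ => rfl
      intro P hP q hq x hx
      have : x = c := by simpa [hp0] using hx
      subst this
      exact hun' _ P hP q hq
    · refine sum_eq_zero fun p hp => ?_
      obtain ⟨⟨-, -, h1⟩, rfl⟩ := (mem_filter.1 hp).2
      exact (hcB h1).elim
  · rw [filter_filter]
    have key : ∑ p ∈ univ.filter (fun p : Path π =>
          (p.origin = c ∧ p.1.IsChain r ∧ p.dest ∈ B) ∧ ¬ p = p0), G p =
        ∑ q ∈ univ.filter (fun q : Path π => r c q.origin ∧ q.1.IsChain r ∧ q.dest ∈ B),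
          wn F π c.1 c.2 * (pathWeight F q *
            ∑ P ∈ (pathsRel π r (A.erase c) (B.erase q.dest)).filter
              (fun P => ∀ q' ∈ P, ∀ x ∈ q.1, x ∉ q'.1), weight F P) := by
      symm
      refine sum_bij (fun q hq => Path.cons c q (hrs _ _ (mem_filter.1 hq).2.1)) ?_ ?_ ?_ ?_
      · intro q hq
        have h := (mem_filter.1 hq).2
        refine mem_filter.2 ⟨mem_univ _, ⟨rfl, (Path.isChain_cons _ _ _).2 ⟨h.1, h.2.1⟩, ?_⟩, ?_⟩
        · rw [Path.dest_cons]; exact h.2.2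
        · intro heq
          have := congrArg (fun p : Path π => p.1) heq
          simp only [Path.cons, hp0, List.cons.injEq, true_and] at this
          exact q.2.1 this
      · intro q _ q' _ heq
        have := congrArg (fun p : Path π => p.1) heq
        simp only [Path.cons, List.cons.injEq, true_and] at this
        exact Subtype.ext this
      · intro p hp
        obtain ⟨⟨hpc, hpr, hpB⟩, hpp⟩ := (mem_filter.1 hp).2
        rcases p.eq_singleton_or_cons with h | ⟨q, hq, hpq⟩
        · exact (hpp (Subtype.ext (by rw [h, hpc]))).elim
        · subst hpc
          rw [hpq] at hpr hpB
          have h4 := (Path.isChain_cons _ _ _).1 hpr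
          rw [Path.dest_cons] at hpB
          exact ⟨q, mem_filter.2 ⟨mem_univ _, h4.1, h4.2, hpB⟩, hpq.symm⟩
      · intro q hq
        simp only [hG, Path.dest_cons]
        have h2 : pathWeight F (Path.cons c q (hrs _ _ (mem_filter.1 hq).2.1)) =
            wn F π c.1 c.2 * pathWeight F q := by simp [pathWeight, Path.cons]
        rw [h2, mul_assoc]
        congr 2
        refine sum_congr (filter_congr ?_) fun _ _ => rfl
        intro P hP
        simp only [Path.cons, List.mem_cons, forall_eq_or_imp]
        exact ⟨fun h q' hq' => ⟨hun' _ P hP q' hq', h q' hq'⟩, fun h q' hq' => (h q' hq').2⟩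
    rw [key]
    rw [← sum_fiberwise_of_maps_to (t := univ.filter fun c' => r c c') (g := fun q => q.origin)
      (fun q hq => mem_filter.2 ⟨mem_univ _, (mem_filter.1 hq).2.1⟩)]
    rw [show (univ.filter fun c' => r c c' ∧ c' ∉ A) =
      (univ.filter fun c' => r c c').filter fun c' => c' ∉ A by rw [filter_filter]]
    symm
    rw [sum_filter]
    refine sum_congr rfl fun c' hc' => ?_
    have hrc := (mem_filter.1 hc').2
    have hcc : c' ≠ c := (Step.lt π (hrs _ _ hrc)).ne
    rw [filter_filter]
    -- If `c'` is already an origin, the system left after popping `q` contains another path through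
    -- `c'`, which contradicts disjointness.
    split_ifs with hcA
    · symm
      refine sum_eq_zero fun q hq => ?_
      have hq' := (mem_filter.1 hq).2.2
      rw [sum_eq_zero, mul_zero, mul_zero]
      intro P hP
      obtain ⟨hP1, hP2⟩ := mem_filter.1 hP
      obtain ⟨hA, hB, hd, hch⟩ := mem_pathsRel.1 hP1
      have : c' ∈ P.image Path.origin := hA ▸ mem_erase.2 ⟨hcc, hcA⟩
      obtain ⟨q', hq'P, hq'c⟩ := mem_image.1 this
      exact (hP2 q' hq'P c' (hq' ▸ q.origin_mem) (hq'c ▸ q'.origin_mem)).elim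
    · rw [pathSum_pop F (mem_insert_self c' _), mul_sum,
        erase_insert (fun h => hcA (mem_of_mem_erase h))]
      refine sum_congr ?_ fun _ _ => rfl
      ext q
      simp only [mem_filter, mem_univ, true_and]
      constructor
      · rintro ⟨h1, h2, h3⟩
        exact ⟨⟨h1 ▸ hrc, h2, h3⟩, h1⟩
      · rintro ⟨⟨h1, h2, h3⟩, h4⟩
        exact ⟨h4, h2, h3⟩

theorem pathSum_empty (r : Cell m → Cell m → Prop) : pathSum F π r ∅ ∅ = 1 := by
  have : pathsRel π r ∅ ∅ = {∅} := by
    ext P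
    rw [mem_pathsRel, mem_singleton]
    constructor
    · rintro ⟨h, -⟩
      exact image_eq_empty.1 h
    · rintro rfl
      simp
  rw [pathSum, this, sum_singleton, weight, prod_empty]

/-- If there are fewer origins than destinations outside a region which no path leaves, then there
are no path systems. -/
theorem pathSum_eq_zero_of_card_lt {r : Cell m → Cell m → Prop} {U : Cell m → Prop}
    (hU : ∀ x y, U x → r x y → U y) {A B : Finset (Cell m)}
    (h : (A.filter fun c => ¬ U c).card < (B.filter fun c => ¬ U c).card) :
    pathSum F π r A B = 0 := by
  refine sum_eq_zero fun P hP => ?_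
  obtain ⟨hA, hB, hd, hch⟩ := mem_pathsRel.1 hP
  refine absurd h (not_lt.2 ?_)
  have hreach : ∀ x y, Relation.ReflTransGen r x y → U x → U y := by
    intro x y hxy hx
    induction hxy with
    | refl => exact hx
    | tail _ h ih => exact hU _ _ ih h
  -- A path ending outside `U` also starts outside `U`, and distinct paths of a system have distinct
  -- origins.
  calc (B.filter fun c => ¬ U c).card
      ≤ ((P.filter fun p => ¬ U p.dest).image Path.dest).card := by
        refine card_le_card fun b hb => ?_
        obtain ⟨h1, h2⟩ := mem_filter.1 hb
        obtain ⟨p, hp, rfl⟩ := mem_image.1 (hB ▸ h1)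
        exact mem_image_of_mem _ (mem_filter.2 ⟨hp, h2⟩)
    _ ≤ (P.filter fun p => ¬ U p.dest).card := card_image_le
    _ ≤ (P.filter fun p => ¬ U p.origin).card := by
        refine card_le_card fun p hp => ?_
        obtain ⟨h1, h2⟩ := mem_filter.1 hp
        exact mem_filter.2 ⟨h1, fun h3 => h2 (hreach _ _ (Path.reach (hch p h1) p.dest_mem) h3)⟩
    _ = ((P.filter fun p => ¬ U p.origin).image Path.origin).card := by
        rw [card_image_of_injOn]
        intro p hp q hq hpq
        exact eq_of_disjoint hd (mem_filter.1 hp).1 (mem_filter.1 hq).1 p.origin_mem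
          (by rw [show p.origin = q.origin from hpq]; exact q.origin_mem)
    _ ≤ (A.filter fun c => ¬ U c).card := by
        refine card_le_card fun a ha => ?_
        obtain ⟨p, hp, rfl⟩ := mem_image.1 ha
        obtain ⟨h1, h2⟩ := mem_filter.1 hp
        exact mem_filter.2 ⟨hA ▸ mem_image_of_mem _ h1, h2⟩

theorem pathSum_eq_zero_of_card_ne {r : Cell m → Cell m → Prop} {A B : Finset (Cell m)}
    (h : A.card ≠ B.card) : pathSum F π r A B = 0 := by
  refine sum_eq_zero fun P hP => (h ?_).elim
  obtain ⟨hA, hB, hd, hch⟩ := mem_pathsRel.1 hP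
  rw [← hA, ← hB, card_image_of_injOn, card_image_of_injOn]
  · intro p hp q hq hpq
    exact eq_of_disjoint hd hp hq p.dest_mem
      (by rw [show p.dest = q.dest from hpq]; exact q.dest_mem)
  · intro p hp q hq hpq
    exact eq_of_disjoint hd hp hq p.origin_mem
      (by rw [show p.origin = q.origin from hpq]; exact q.origin_mem)

theorem pathSum_eq_zero_of_not_le {r : Cell m → Cell m → Prop} {A B : Finset (Cell m)} {a : Cell m}
    (ha : a ∈ A) (h : ∀ b ∈ B, ¬ b ≤ a) : pathSum F π r A B = 0 := by
  refine sum_eq_zero fun P hP => ?_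
  obtain ⟨hA, hB, hd, hch⟩ := mem_pathsRel.1 hP
  obtain ⟨p, hp, rfl⟩ := mem_image.1 (hA ▸ ha)
  exact (h p.dest (hB ▸ mem_image_of_mem _ hp) (Path.dest_le p.origin_mem)).elim

theorem isChain_iff_of_agree {α : Type*} {r r' : α → α → Prop} {G : α → α → Prop} {l : List α}
    (hne : l ≠ [])
    (h : ∀ x y, Relation.ReflTransGen r (l.head hne) x → G x y → (r x y ↔ r' x y))
    (hl : l.IsChain G) : l.IsChain r ↔ l.IsChain r' := by
  induction l with
  | nil => simp
  | cons a l ih =>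
    rcases l with _ | ⟨b, l⟩
    · simp
    · obtain ⟨h1, h2⟩ := List.isChain_cons_cons.1 hl
      have h3 := h a b .refl h1
      rw [List.isChain_cons_cons, List.isChain_cons_cons, ← h3]
      refine and_congr_right fun hab => ih (by simp) (fun x y hx => ?_) h2
      exact h x y ((Relation.ReflTransGen.single hab).trans hx)

/-- Path sums depend only on the steps that are relevant for them. -/
theorem pathSum_congr_rel {r r' : Cell m → Cell m → Prop} {A B : Finset (Cell m)}
    (h : ∀ a ∈ A, ∀ b ∈ B, ∀ x y, Relation.ReflTransGen r a x → b ≤ y → Step π x y →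
      (r x y ↔ r' x y)) : pathSum F π r A B = pathSum F π r' A B := by
  refine sum_congr (filter_congr fun P hP => ?_) fun _ _ => rfl
  obtain ⟨hA, hB, hd⟩ := (mem_filter.1 hP).2
  refine forall₂_congr fun p hp => ?_
  refine isChain_iff_of_agree (G := fun x y => Step π x y ∧ p.dest ≤ y) p.2.1 ?_ ?_
  · rintro x y hx ⟨h1, h2⟩
    exact h _ (hA ▸ mem_image_of_mem _ hp) _ (hB ▸ mem_image_of_mem _ hp) x y hx h2 h1
  · rw [List.isChain_iff_getElem]
    intro i hi
    exact ⟨List.isChain_iff_getElem.1 p.2.2.2 i hi, Path.dest_le (List.getElem_mem _)⟩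

end PathSystems

/-! ### Splitting and exchange of path systems -/

section Exchange

open scoped Classical

variable {m : ℕ} {π : Equiv.Perm (Fin (m + 1))}

theorem isFree_iff {k b : Fin (m + 1)} : IsFree π (k, b) ↔ π k < b ∧ π.symm b < k := by
  simp [IsFree, Inv]

/-- Weak inequalities treat the entries `1` and the free variables uniformly, because equality in
either one forces `π k = b`. -/
theorem isNz_iff {k b : Fin (m + 1)} : IsNz π (k, b) ↔ π k ≤ b ∧ π.symm b ≤ k := by
  rw [IsNz, isFree_iff]
  constructor
  · rintro (h | h)
    · have h : π k = b := h
      subst h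
      simp
    · exact ⟨h.1.le, h.2.le⟩
  · rintro ⟨h1, h2⟩
    rcases h1.eq_or_lt with h | h
    · exact Or.inl h
    · refine Or.inr ⟨h, lt_of_le_of_ne h2 ?_⟩
      rintro rfl
      simp at h

theorem mem_rowSupport {k b : Fin (m + 1)} : b ∈ rowSupport π k ↔ π k ≤ b ∧ π.symm b ≤ k := by
  rw [← isNz_iff]
  simp [rowSupport]

/-- The measure for inductions over sets of origins. -/
def cellMeasure (A : Finset (Cell m)) : ℕ := ∑ c ∈ A, ((c.1 : ℕ) + c.2 + 1)

/-- The summand `+ 1` in the measure keeps the decrease strict even at the cell `(0, 0)`. -/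
theorem cellMeasure_erase_lt {A : Finset (Cell m)} {c : Cell m} (hc : c ∈ A) :
    cellMeasure (A.erase c) < cellMeasure A := by
  have := add_sum_erase A (fun c : Cell m => ((c.1 : ℕ) + c.2 + 1)) hc
  simp only [cellMeasure]
  omega

theorem cellMeasure_insert_lt {A : Finset (Cell m)} {c c' : Cell m} (hc : c ∈ A)
    (h : Step π c c') : cellMeasure (insert c' (A.erase c)) < cellMeasure A := by
  have h1 := add_sum_erase A (fun c : Cell m => ((c.1 : ℕ) + c.2 + 1)) hc
  have h2 : (c'.1 : ℕ) + c'.2 < c.1 + c.2 := by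
    rcases h.2.2 with ⟨h3, h4, -⟩ | ⟨h3, h4, -⟩
    · rw [h3]; have := Fin.lt_def.1 h4; omega
    · rw [h3]; have := Fin.lt_def.1 h4; omega
  simp only [cellMeasure]
  by_cases h3 : c' ∈ A.erase c
  · rw [insert_eq_of_mem h3]; omega
  · rw [sum_insert h3]; omega

variable (F : Type*) [Field F]

/-- If outside a region which no path leaves there are as many origins as destinations, then path
systems split. -/
theorem pathSum_split {r : Cell m → Cell m → Prop} (hrs : ∀ x y, r x y → Step π x y)
    {U : Cell m → Prop} (hU : ∀ x y, U x → r x y → U y) (A₁ A₂ B₁ B₂ : Finset (Cell m))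
    (hA₁ : ∀ a ∈ A₁, ¬ U a) (hA₂ : ∀ a ∈ A₂, U a) (hB₁ : ∀ a ∈ B₁, ¬ U a) (hB₂ : ∀ a ∈ B₂, U a)
    (hcard : A₁.card = B₁.card) :
    pathSum F π r (A₁ ∪ A₂) (B₁ ∪ B₂) = pathSum F π r A₁ B₁ * pathSum F π r A₂ B₂ := by
  induction hn : cellMeasure A₁ using Nat.strong_induction_on generalizing A₁ B₁ with
  | _ n ih =>
  subst hn
  rcases A₁.eq_empty_or_nonempty with rfl | hne
  · have : B₁ = ∅ := by simpa using hcard.symm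
    subst this
    simp [pathSum_empty]
  -- Steps decrease cells, so no other origin of `A₁` reaches a maximal one; no origin of `A₂`
  -- reaches it either, since paths do not leave `U`.
  obtain ⟨c, hc⟩ := A₁.exists_maximal hne
  have hcA : c ∈ A₁ := hc.prop
  have hcU := hA₁ c hcA
  have hcA₂ : c ∉ A₂ := fun h => hcU (hA₂ c h)
  have hcB₂ : c ∉ B₂ := fun h => hcU (hB₂ c h)
  have hreach : ∀ x y, Relation.ReflTransGen r x y → U x → U y := by
    intro x y hxy hx
    induction hxy with
    | refl => exact hx
    | tail _ h ih => exact hU _ _ ih h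
  have hun₁ : ∀ a ∈ A₁, a ≠ c → ¬ Relation.ReflTransGen r a c := fun a ha hac h =>
    hac (le_antisymm (hc.2 ha (reflTransGen_le hrs h)) (reflTransGen_le hrs h))
  have hun : ∀ a ∈ A₁ ∪ A₂, a ≠ c → ¬ Relation.ReflTransGen r a c := by
    intro a ha hac h
    rcases mem_union.1 ha with ha | ha
    · exact hun₁ a ha hac h
    · exact hcU (hreach _ _ h (hA₂ a ha))
  rw [pathSum_rec F hrs (mem_union_left _ hcA) hun, pathSum_rec F hrs hcA hun₁, add_mul, sum_mul,
    sum_filter, sum_filter, erase_union_distrib, erase_union_distrib, erase_eq_of_notMem hcA₂,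
    erase_eq_of_notMem hcB₂]
  congr 1
  · by_cases hcB : c ∈ B₁
    · rw [if_pos (mem_union_left _ hcB), if_pos hcB, ih _ (cellMeasure_erase_lt hcA) _ _
        (fun a ha => hA₁ a (mem_of_mem_erase ha)) (fun a ha => hB₁ a (mem_of_mem_erase ha))
        (by rw [card_erase_of_mem hcA, card_erase_of_mem hcB, hcard]) rfl, mul_assoc]
    · rw [if_neg (by simp [hcB, hcB₂]), if_neg hcB, zero_mul]
  · refine sum_congr rfl fun c' _ => ?_
    by_cases hr : r c c'
    swap
    · simp [hr]
    -- A step into `U` leaves fewer origins than destinations outside `U`, so both sides of the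
    -- recursion contribute zero.
    by_cases hcU' : U c'
    · have hz : ∀ A B : Finset (Cell m), (∀ a ∈ A, U a) → (∀ b ∈ B, U b) →
          pathSum F π r (insert c' (A₁.erase c ∪ A)) (B₁ ∪ B) = 0 := by
        intro A B hA hB
        refine pathSum_eq_zero_of_card_lt F hU ?_
        calc ((insert c' (A₁.erase c ∪ A)).filter fun c => ¬ U c).card
            ≤ (A₁.erase c).card := by
              refine card_le_card fun x hx => ?_
              obtain ⟨h1, h2⟩ := mem_filter.1 hx
              rcases mem_insert.1 h1 with rfl | h1
              · exact (h2 hcU').elim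
              · rcases mem_union.1 h1 with h1 | h1
                · exact h1
                · exact (h2 (hA x h1)).elim
          _ < B₁.card := by
              rw [card_erase_of_mem hcA, ← hcard]
              exact Nat.pred_lt (card_pos.2 hne).ne'
          _ ≤ _ := card_le_card fun x hx => mem_filter.2 ⟨mem_union_left _ hx, hB₁ x hx⟩
      have h1 := hz A₂ B₂ hA₂ hB₂
      have h2 := hz ∅ ∅ (by simp) (by simp)
      simp only [union_empty] at h2
      rw [h1, h2]
      simp
    · have hc'A₂ : c' ∉ A₂ := fun h => hcU' (hA₂ c' h)
      by_cases hc'A : c' ∈ A₁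
      · simp [hc'A]
      · have hcc' : c' ≠ c := fun h => hc'A (h ▸ hcA)
        rw [if_pos ⟨hr, by simp [hc'A, hc'A₂]⟩, if_pos ⟨hr, hc'A⟩, ← insert_union,
          ih _ (cellMeasure_insert_lt hcA (hrs _ _ hr)) _ _ ?_ hB₁ ?_ rfl, mul_assoc]
        · intro a ha
          rcases mem_insert.1 ha with rfl | ha
          · exact hcU'
          · exact hA₁ a (mem_of_mem_erase ha)
        · rw [card_insert_of_notMem (fun h => hc'A (mem_of_mem_erase h)), card_erase_of_mem hcA,
            ← hcard]
          have := card_pos.2 hne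
          omega

/-- The product of the nonzero entries of row `e` up to column `b`. -/
def segProd (π : Equiv.Perm (Fin (m + 1))) (e b : Fin (m + 1)) : RatFun F π :=
  ∏ b' ∈ (rowSupport π e).filter (fun b' => b' ≤ b), wn F π e b'

theorem exists_left_neighbor {e b : Fin (m + 1)} (h : IsNz π (e, b)) (hb : b ≠ π e) :
    ∃ b', b' < b ∧ Step π (e, b) (e, b') ∧ (∀ c, Step π (e, b) c → c.1 = e → c = (e, b')) ∧
      (∀ b'', IsNz π (e, b'') → b'' < b → b'' ≤ b') ∧
      segProd F π e b = wn F π e b * segProd F π e b' := by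
  have hlt : π e < b := lt_of_le_of_ne (isNz_iff.1 h).1 hb.symm
  have hne : ((rowSupport π e).filter fun b' => b' < b).Nonempty :=
    ⟨π e, mem_filter.2 ⟨mem_rowSupport.2 (by simp), hlt⟩⟩
  obtain ⟨hm1, hm2⟩ := mem_filter.1 (max'_mem _ hne)
  set b' := ((rowSupport π e).filter fun b' => b' < b).max' hne with hb'
  have hmax : ∀ b'', IsNz π (e, b'') → b'' < b → b'' ≤ b' := fun b'' h1 h2 =>
    le_max' _ _ (mem_filter.2 ⟨mem_rowSupport.2 (isNz_iff.1 h1), h2⟩)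
  have hnz' : IsNz π (e, b') := isNz_iff.2 (mem_rowSupport.1 hm1)
  refine ⟨b', hm2, ⟨h, hnz', Or.inr ⟨rfl, hm2, fun b'' h1 h2 h3 =>
    absurd (hmax b'' h3 h2) (not_le.2 h1)⟩⟩, ?_, hmax, ?_⟩
  · rintro ⟨k, x⟩ hs (rfl : k = e)
    rcases hs.2.2 with ⟨-, h1, -⟩ | ⟨-, h1, h2⟩
    · exact absurd h1 (lt_irrefl _)
    · have h3 : x ≤ b' := hmax x hs.2.1 h1
      rcases h3.eq_or_lt with rfl | h3
      · rfl
      · exact (h2 b' h3 hm2 hnz').elim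
  · rw [segProd, segProd, ← prod_insert (f := fun x => wn F π e x)]
    · congr 1
      ext x
      simp only [mem_filter, mem_insert]
      constructor
      · rintro ⟨h1, h2⟩
        rcases h2.eq_or_lt with rfl | h2
        · exact Or.inl rfl
        · exact Or.inr ⟨h1, hmax x (isNz_iff.2 (mem_rowSupport.1 h1)) h2⟩
      · rintro (rfl | ⟨h1, h2⟩)
        · exact ⟨mem_rowSupport.2 (isNz_iff.1 h), le_rfl⟩
        · exact ⟨h1, h2.trans hm2.le⟩
    · simp [hm2]

/-- Every nonzero entry lies weakly to the right of the `1` of its row and weakly below the `1` of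
its column, so a path that meets an entry `1` ends there. -/
theorem not_step_one {e : Fin (m + 1)} (c : Cell m) : ¬ Step π (e, π e) c := by
  obtain ⟨k, b⟩ := c
  rintro ⟨-, h, ⟨h1, h2, -⟩ | ⟨h1, h2, -⟩⟩ <;> dsimp only at h1 h2 <;> subst h1 <;>
    have h3 := isNz_iff.1 h
  · simp only [Equiv.symm_apply_apply] at h3
    exact absurd h2 (not_lt.2 h3.2)
  · exact absurd h2 (not_lt.2 h3.1)

theorem Step.row_le {c c' : Cell m} (h : Step π c c') : c'.1 ≤ c.1 :=
  (Prod.le_def.1 (Step.lt π h).le).1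

theorem Step.col_le {c c' : Cell m} (h : Step π c c') : c'.2 ≤ c.2 :=
  (Prod.le_def.1 (Step.lt π h).le).2

/-- The only path inside a row from an entry to the entry `1`. -/
theorem pathSum_segment {r : Cell m → Cell m → Prop} (hrs : ∀ x y, r x y → Step π x y)
    (hrow : ∀ x y, Step π x y → y.1 = x.1 → r x y) (e b : Fin (m + 1)) (hb : IsNz π (e, b)) :
    pathSum F π r {(e, b)} {(e, π e)} = segProd F π e b := by
  induction hn : (b : ℕ) using Nat.strong_induction_on generalizing b with
  | _ n ih =>
  subst hn
  rw [pathSum_rec F hrs (mem_singleton_self _) (by simp)]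
  by_cases hbe : b = π e
  · subst hbe
    rw [if_pos (mem_singleton_self _), sum_eq_zero]
    · have : (rowSupport π e).filter (fun b' => b' ≤ π e) = {π e} := by
        ext x
        rw [mem_filter, mem_rowSupport, mem_singleton]
        constructor
        · exact fun h => le_antisymm h.2 h.1.1
        · rintro rfl
          simp
      simp [pathSum_empty, segProd, this]
    · intro c hc
      exact (not_step_one c (hrs _ _ (mem_filter.1 hc).2.1)).elim
  · obtain ⟨b', hlt, hs, huniq, hmax, hseg⟩ := exists_left_neighbor F hb hbe
    rw [if_neg (by simp [hbe]), zero_add, sum_eq_single (e, b')]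
    · rw [hseg, ← ih _ hlt b' hs.2.1 rfl]
      simp
    · intro c hc hcb
      have hst := hrs _ _ (mem_filter.1 hc).2.1
      -- Any step other than the one to the left leaves row `e` upwards, and paths never descend to
      -- the destination in row `e`.
      rw [pathSum_eq_zero_of_not_le F (mem_insert_self c _), mul_zero]
      intro x hx hle
      rw [mem_singleton.1 hx] at hle
      have h1 := (Prod.le_def.1 hle).1
      exact hcb (huniq c hst (le_antisymm hst.row_le h1))
    · intro h
      refine (h (mem_filter.2 ⟨mem_univ _, hrow _ _ hs rfl, ?_⟩)).elim
      simp [hlt.ne]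

/-- Separates the unique step to the left from the steps that leave the row, since the two kinds are
treated differently in the exchange argument. -/
theorem sum_steps_eq {r : Cell m → Cell m → Prop} (hrs : ∀ x y, r x y → Step π x y)
    {e b b' : Fin (m + 1)} (hr : r (e, b) (e, b'))
    (hu : ∀ c, Step π (e, b) c → c.1 = e → c = (e, b')) (A : Finset (Cell m))
    (f : Cell m → RatFun F π) :
    ∑ c ∈ univ.filter (fun c => r (e, b) c ∧ c ∉ A), f c =
      (if (e, b') ∉ A then f (e, b') else 0) +
        ∑ c ∈ univ.filter (fun c => r (e, b) c ∧ c.1 < e ∧ c ∉ A), f c := by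
  rw [← sum_filter_add_sum_filter_not _ (fun c : Cell m => c.1 = e), filter_filter, filter_filter]
  congr 1
  · split_ifs with h
    · refine sum_eq_zero fun c hc => ?_
      obtain ⟨⟨h1, h2⟩, h3⟩ := (mem_filter.1 hc).2
      exact (h2 ((hu c (hrs _ _ h1) h3).symm ▸ h)).elim
    · rw [sum_eq_single (e, b')]
      · intro c hc hne
        obtain ⟨⟨h1, h2⟩, h3⟩ := (mem_filter.1 hc).2
        exact (hne (hu c (hrs _ _ h1) h3)).elim
      · intro h1
        exact (h1 (mem_filter.2 ⟨mem_univ _, ⟨hr, h⟩, rfl⟩)).elim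
  · refine sum_congr (filter_congr fun c _ => ?_) fun _ _ => rfl
    constructor
    · rintro ⟨⟨h1, h2⟩, h3⟩
      exact ⟨h1, lt_of_le_of_ne (hrs _ _ h1).row_le h3, h2⟩
    · rintro ⟨h1, h2, h3⟩
      exact ⟨⟨h1, h3⟩, h2.ne⟩

/-- The exchange identity for two origins `y < o` in row `e`, by induction on `o` moving left. As
long as `o` stays in the row, both sides acquire the same factor; once its path turns up, the path
from `y` must run along the row to the entry `1`. -/
theorem pathSum_exchange_row {r : Cell m → Cell m → Prop} (hrs : ∀ x y, r x y → Step π x y)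
    (hrow : ∀ x y, Step π x y → y.1 = x.1 → r x y) {e y : Fin (m + 1)} (hy : IsNz π (e, y))
    {A B : Finset (Cell m)} (hA : ∀ a ∈ A, a.1 < e) (hB : ∀ b ∈ B, b.1 < e) (o : Fin (m + 1))
    (ho : IsNz π (e, o)) (hyo : y < o) :
    pathSum F π r (insert (e, o) (insert (e, y) A)) (insert (e, π e) B) +
      segProd F π e o * pathSum F π r (insert (e, y) A) B =
      pathSum F π r (insert (e, o) A) B * segProd F π e y := by
  induction hn : (o : ℕ) using Nat.strong_induction_on generalizing o with
  | _ n ih =>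
  subst hn
  have hye : π e ≤ y := (isNz_iff.1 hy).1
  have hoe : o ≠ π e := (hye.trans_lt hyo).ne'
  obtain ⟨o', hlt, hs, huniq, hmax, hseg⟩ := exists_left_neighbor F ho hoe
  have hyo' : y ≤ o' := hmax y hy hyo
  have hoA : ∀ x, (e, x) ∉ A := fun x h => lt_irrefl _ (hA _ h)
  have hoB : ∀ x, (e, x) ∉ B := fun x h => lt_irrefl _ (hB _ h)
  have hreach : ∀ a, Relation.ReflTransGen r a (e, o) → e ≤ a.1 ∧ o ≤ a.2 := fun a h =>
    Prod.le_def.1 (reflTransGen_le hrs h)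
  have hun : ∀ a ∈ insert (e, o) A, a ≠ (e, o) → ¬ Relation.ReflTransGen r a (e, o) := by
    intro a ha hne h
    rcases mem_insert.1 ha with rfl | ha
    · exact hne rfl
    · exact absurd (hA a ha) (not_lt.2 (hreach a h).1)
  have hun' : ∀ a ∈ insert (e, o) (insert (e, y) A), a ≠ (e, o) →
      ¬ Relation.ReflTransGen r a (e, o) := by
    intro a ha hne h
    rcases mem_insert.1 ha with rfl | ha
    · exact hne rfl
    · rcases mem_insert.1 ha with rfl | ha
      · exact absurd hyo (not_lt.2 (hreach _ h).2)
      · exact absurd (hA a ha) (not_lt.2 (hreach a h).1)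
  have hU : ∀ x z : Cell m, x.1 < e → r x z → z.1 < e := fun x z h1 h2 =>
    (hrs _ _ h2).row_le.trans_lt h1
  -- After `o` has left row `e`, only the path from `y` can serve the destination in that row, and
  -- it contributes `segProd F π e y`.
  have hup : ∀ c : Cell m, c.1 < e →
      pathSum F π r (insert c (insert (e, y) A)) (insert (e, π e) B) =
        segProd F π e y * pathSum F π r (insert c A) B := by
    intro c hc
    have := pathSum_split F hrs hU {(e, y)} (insert c A) {(e, π e)} B (by simp)
      (by simpa using ⟨hc, fun a b h => hA _ h⟩) (by simp) hB (by simp)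
    rw [pathSum_segment F hrs hrow e y hy] at this
    rw [← this]
    congr 1
    ext x
    simp only [mem_insert, mem_union, mem_singleton]
    tauto
  rw [pathSum_rec F hrs (mem_insert_self _ _) hun', if_neg (by simp [hoe, hoB]), zero_add,
    pathSum_rec F hrs (mem_insert_self _ _) hun, if_neg (hoB o), zero_add,
    sum_steps_eq F hrs (hrow _ _ hs rfl) huniq, sum_steps_eq F hrs (hrow _ _ hs rfl) huniq,
    erase_insert (by simp [hyo.ne', hoA]), erase_insert (hoA o),
    if_pos (show (e, o') ∉ insert (e, o) A by simp [hlt.ne, hoA]), hseg]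
  have hsum : ∑ c ∈ univ.filter (fun c => r (e, o) c ∧ c.1 < e ∧
        c ∉ insert (e, o) (insert (e, y) A)),
      wn F π (e, o).1 (e, o).2 *
        pathSum F π r (insert c (insert (e, y) A)) (insert (e, π e) B) =
      (∑ c ∈ univ.filter (fun c => r (e, o) c ∧ c.1 < e ∧ c ∉ insert (e, o) A),
        wn F π (e, o).1 (e, o).2 * pathSum F π r (insert c A) B) * segProd F π e y := by
    rw [sum_mul]
    refine sum_congr (filter_congr fun c _ => ?_) fun c hc => ?_
    · refine and_congr_right fun _ => and_congr_right fun hc => ?_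
      have : c ≠ (e, y) := fun h => by rw [h] at hc; exact lt_irrefl _ hc
      simp [this]
    · rw [hup c (mem_filter.1 hc).2.2.1]
      ring
  rw [hsum]
  -- If the left neighbour of `o` is `y`, the leftward step is blocked in the two-origin sum, and
  -- the product of the segment supplies the missing term. Otherwise the induction hypothesis
  -- applies to that neighbour.
  rcases hyo'.eq_or_lt with rfl | hyo'
  · rw [if_neg (by simp)]
    ring
  · rw [if_pos (by simp [hlt.ne, hoA, hyo'.ne'])]
    linear_combination wn F π e o * ih _ hlt o' hs.2.1 hyo' rfl

/-- The exchange identity: a path system crossing row `e` below a path system starting in row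
`e`. -/
theorem pathSum_exchange {r : Cell m → Cell m → Prop} (hrs : ∀ x y, r x y → Step π x y)
    (hrow : ∀ x y, Step π x y → y.1 = x.1 → r x y) {e o : Fin (m + 1)} (ho : IsNz π (e, o))
    (homax : ∀ b, IsNz π (e, b) → b ≤ o) {A' B' : Finset (Cell m)}
    (hA' : ∀ a ∈ A', a.1 < e) (hB' : ∀ b ∈ B', b.1 < e) (hB'c : ∀ b ∈ B', π e ≤ b.2)
    (A B : Finset (Cell m)) (hA : ∀ a ∈ A, e < a.1) (hB : ∀ b ∈ B, e < b.1)
    (hBc : ∀ b ∈ B, π e ≤ b.2) (hcard : A.card = B.card + 1) :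
    pathSum F π r (A ∪ insert (e, o) A') (B ∪ insert (e, π e) B') +
      segProd F π e o * pathSum F π r (A ∪ A') (B ∪ B') =
      pathSum F π r (insert (e, o) A') B' * pathSum F π r A (insert (e, π e) B) := by
  induction hn : cellMeasure A using Nat.strong_induction_on generalizing A B with
  | _ n ih =>
  subst hn
  have hne : A.Nonempty := card_pos.1 (by omega)
  -- The recursion is applied at `c` to the three sums involving `A`; the identity is then checked
  -- separately for stopping at `c` and for each possible step from `c` to `c'`.
  obtain ⟨c, hc⟩ := A.exists_maximal hne
  have hcA : c ∈ A := hc.prop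
  have hce := hA c hcA
  have hnot : ∀ X : Finset (Cell m), (∀ a ∈ X, a.1 ≤ e) → c ∉ X :=
    fun X hX h => absurd hce (not_lt.2 (hX c h))
  have hX1 : ∀ a ∈ insert (e, o) A', a.1 ≤ e := by
    intro a ha
    rcases mem_insert.1 ha with rfl | ha
    · exact le_rfl
    · exact (hA' a ha).le
  have hY1 : ∀ a ∈ insert (e, π e) B', a.1 ≤ e := by
    intro a ha
    rcases mem_insert.1 ha with rfl | ha
    · exact le_rfl
    · exact (hB' a ha).le
  have hcc : ∀ a, Relation.ReflTransGen r a c → c ≤ a := fun a h => reflTransGen_le hrs h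
  have hun : ∀ X : Finset (Cell m), (∀ a ∈ X, a.1 ≤ e) → ∀ a ∈ A ∪ X, a ≠ c →
      ¬ Relation.ReflTransGen r a c := by
    intro X hX a ha hac h
    rcases mem_union.1 ha with ha | ha
    · exact hac (le_antisymm (hc.2 ha (hcc a h)) (hcc a h))
    · exact absurd hce (not_lt.2 ((Prod.le_def.1 (hcc a h)).1.trans (hX a ha)))
  have hun0 := hun ∅ (by simp)
  rw [union_empty] at hun0
  have hct : c ≠ (e, π e) := fun h => by rw [h] at hce; exact lt_irrefl _ hce
  rw [pathSum_rec F hrs (mem_union_left _ hcA) (hun _ hX1),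
    pathSum_rec F hrs (mem_union_left _ hcA) (hun A' fun a ha => (hA' a ha).le),
    pathSum_rec F hrs hcA hun0, sum_filter, sum_filter, sum_filter,
    erase_union_distrib, erase_union_distrib, erase_union_distrib, erase_union_distrib,
    erase_eq_of_notMem (hnot _ hX1), erase_eq_of_notMem (hnot _ hY1),
    erase_eq_of_notMem (hnot A' fun a ha => (hA' a ha).le),
    erase_eq_of_notMem (hnot B' fun a ha => (hB' a ha).le), erase_insert_of_ne hct.symm]
  have hcB1 : c ∈ B ∪ insert (e, π e) B' ↔ c ∈ B := by
    rw [mem_union]; exact or_iff_left (hnot _ hY1)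
  have hcB2 : c ∈ B ∪ B' ↔ c ∈ B := by
    rw [mem_union]; exact or_iff_left (hnot _ fun a ha => (hB' a ha).le)
  have hcB3 : c ∈ insert (e, π e) B ↔ c ∈ B := by
    rw [mem_insert]; exact or_iff_right hct
  simp only [hcB1, hcB2, hcB3]
  have hfirst : (if c ∈ B then wn F π c.1 c.2 * pathSum F π r (A.erase c ∪ insert (e, o) A')
        (B.erase c ∪ insert (e, π e) B') else 0) +
      segProd F π e o * (if c ∈ B then wn F π c.1 c.2 *
        pathSum F π r (A.erase c ∪ A') (B.erase c ∪ B') else 0) =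
      pathSum F π r (insert (e, o) A') B' * (if c ∈ B then wn F π c.1 c.2 *
        pathSum F π r (A.erase c) (insert (e, π e) (B.erase c)) else 0) := by
    split_ifs with hcB
    · have := ih _ (cellMeasure_erase_lt hcA) (A.erase c) (B.erase c)
        (fun a ha => hA a (mem_of_mem_erase ha)) (fun a ha => hB a (mem_of_mem_erase ha))
        (fun a ha => hBc a (mem_of_mem_erase ha)) (by
          rw [card_erase_of_mem hcA, card_erase_of_mem hcB, hcard]
          have := card_pos.2 ⟨c, hcB⟩
          omega) rfl
      linear_combination wn F π c.1 c.2 * this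
    · ring
  have hsecond : ∀ c', (if r c c' ∧ c' ∉ A ∪ insert (e, o) A' then wn F π c.1 c.2 *
        pathSum F π r (insert c' (A.erase c ∪ insert (e, o) A')) (B ∪ insert (e, π e) B') else 0) +
      segProd F π e o * (if r c c' ∧ c' ∉ A ∪ A' then wn F π c.1 c.2 *
        pathSum F π r (insert c' (A.erase c ∪ A')) (B ∪ B') else 0) =
      pathSum F π r (insert (e, o) A') B' * (if r c c' ∧ c' ∉ A then wn F π c.1 c.2 *
        pathSum F π r (insert c' (A.erase c)) (insert (e, π e) B) else 0) := by
    intro c'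
    by_cases hr : r c c'
    swap
    · simp [hr]
    have hst := hrs _ _ hr
    rcases lt_trichotomy c'.1 e with hlt | heq | hgt
    -- An upward step that jumps over row `e` passes a zero entry there. Its column is therefore to
    -- the left of `π e`, while every destination is in or to the right of column `π e`, so all
    -- three terms vanish.
    · have hcol : c'.2 < π e := by
        rcases hst.2.2 with ⟨h1, h2, h3⟩ | ⟨h1, h2, h3⟩
        · by_contra hcon
          rw [not_lt] at hcon
          have h4 := isNz_iff.1 hst.2.1
          exact h3 e hlt hce (isNz_iff.2 ⟨h1 ▸ hcon, h1 ▸ h4.2.trans hlt.le⟩)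
        · rw [h1] at hlt
          exact absurd hlt (not_lt.2 hce.le)
      have hz : ∀ X Y, (∀ b ∈ Y, π e ≤ b.2) → pathSum F π r (insert c' X) Y = 0 := by
        intro X Y hY
        refine pathSum_eq_zero_of_not_le F (mem_insert_self _ _) fun b hb hle => ?_
        exact absurd hcol (not_lt.2 ((hY b hb).trans (Prod.le_def.1 hle).2))
      rw [hz _ _ ?_, hz _ _ ?_, hz _ _ ?_]
      · simp
      · intro b hb
        rcases mem_insert.1 hb with rfl | hb
        · exact le_rfl
        · exact hBc b hb
      · intro b hb
        rcases mem_union.1 hb with hb | hb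
        · exact hBc b hb
        · exact hB'c b hb
      · intro b hb
        rcases mem_union.1 hb with hb | hb
        · exact hBc b hb
        · rcases mem_insert.1 hb with rfl | hb
          · exact le_rfl
          · exact hB'c b hb
    · obtain ⟨k, y⟩ := c'
      dsimp only at heq
      subst heq
      have hyA : (k, y) ∉ A := fun h => lt_irrefl _ (hA _ h)
      have hyA' : (k, y) ∉ A' := fun h => lt_irrefl _ (hA' _ h)
      have hy : IsNz π (k, y) := hst.2.1
      have hU : ∀ x z : Cell m, x.1 ≤ k → r x z → z.1 ≤ k := fun x z h1 h2 =>
        (hrs _ _ h2).row_le.trans h1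
      have hcard' : (A.erase c).card = B.card := by
        rw [card_erase_of_mem hcA, hcard]; rfl
      have hsp : ∀ X Y, (∀ a ∈ X, a.1 ≤ k) → (∀ b ∈ Y, b.1 ≤ k) →
          pathSum F π r (insert (k, y) (A.erase c ∪ X)) (B ∪ Y) =
            pathSum F π r (A.erase c) B * pathSum F π r (insert (k, y) X) Y := by
        intro X Y hX hY
        rw [← union_insert, pathSum_split F hrs hU]
        · exact fun a ha => not_le.2 (hA a (mem_of_mem_erase ha))
        · intro a ha
          rcases mem_insert.1 ha with rfl | ha
          · exact le_rfl
          · exact hX a ha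
        · exact fun a ha => not_le.2 (hB a ha)
        · exact hY
        · exact hcard'
      have h3 := hsp ∅ {(k, π k)} (by simp) (by simp)
      rw [union_empty, union_comm B, ← insert_eq, insert_empty_eq,
        pathSum_segment F hrs hrow k y hy] at h3
      rw [h3, hsp _ _ hX1 hY1, hsp _ _ (fun a ha => (hA' a ha).le) (fun a ha => (hB' a ha).le),
        if_pos (show r c (k, y) ∧ (k, y) ∉ A ∪ A' from ⟨hr, by simp [hyA, hyA']⟩),
        if_pos (show r c (k, y) ∧ (k, y) ∉ A from ⟨hr, hyA⟩)]
      -- The path has just entered row `e` and the part below splits off. Landing on `o` itself is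
      -- forbidden in the first sum; landing further left is the exchange inside the row.
      rcases (homax y hy).eq_or_lt with rfl | hyo
      · rw [if_neg (by simp)]
        ring
      · rw [if_pos ⟨hr, by simp [hyA, hyA', hyo.ne]⟩, insert_comm]
        linear_combination wn F π c.1 c.2 * pathSum F π r (A.erase c) B *
          pathSum_exchange_row F hrs hrow hy hA' hB' o ho hyo
    · have hX : ∀ X : Finset (Cell m), (∀ a ∈ X, a.1 ≤ e) → c' ∉ X :=
        fun X hX h => absurd hgt (not_lt.2 (hX c' h))
      have h1 : c' ∉ A ∪ insert (e, o) A' ↔ c' ∉ A := by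
        rw [mem_union]; exact not_congr (or_iff_left (hX _ hX1))
      have h2 : c' ∉ A ∪ A' ↔ c' ∉ A := by
        rw [mem_union]; exact not_congr (or_iff_left (hX _ fun a ha => (hA' a ha).le))
      simp only [h1, h2, hr, true_and]
      split_ifs with hcA'
      · simp
      have := ih _ (cellMeasure_insert_lt hcA hst) (insert c' (A.erase c)) B
        (by
          intro a ha
          rcases mem_insert.1 ha with rfl | ha
          · exact hgt
          · exact hA a (mem_of_mem_erase ha)) hB hBc
        (by
          rw [card_insert_of_notMem (fun h => hcA' (mem_of_mem_erase h)), card_erase_of_mem hcA,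
            hcard]; rfl) rfl
      rw [insert_union, insert_union] at this
      linear_combination wn F π c.1 c.2 * this
  rw [mul_add, mul_add, ← hfirst, mul_sum, mul_sum, ← sum_congr rfl fun c' _ => hsecond c',
    sum_add_distrib]
  ring

end Exchange

/-! ### Single-row decompositions below the row of the last `1` -/

section LeftSums

open scoped Classical

variable {m : ℕ} {π : Equiv.Perm (Fin (m + 1))}

/-- The steps of `w n` other than the upward steps in the rightmost column that start in or below
row `t`. -/
def StepCut (π : Equiv.Perm (Fin (m + 1))) (t : ℕ) (x y : Cell m) : Prop :=
  Step π x y ∧ ¬ (y.2 = x.2 ∧ x.2 = Fin.last m ∧ t ≤ (x.1 : ℕ))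

theorem StepCut.step {t : ℕ} (x y : Cell m) (h : StepCut π t x y) : Step π x y := h.1

theorem StepCut.of_row {t : ℕ} (x y : Cell m) (h : Step π x y) (hr : y.1 = x.1) :
    StepCut π t x y := by
  refine ⟨h, fun h' => ?_⟩
  exact (Step.lt π h).ne (Prod.ext hr h'.1)

/-- The cell of row `k` in the rightmost column. -/
def lastCell (k : Fin (m + 1)) : Cell m := (k, Fin.last m)

theorem lastCell_injective : Function.Injective (lastCell : Fin (m + 1) → Cell m) :=
  fun _ _ h => congrArg Prod.fst h

theorem isNz_last {k : Fin (m + 1)} : IsNz π (k, Fin.last m) ↔ π.symm (Fin.last m) ≤ k := by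
  rw [isNz_iff]
  exact and_iff_right (Fin.le_last _)

/-- The rows from `k` to `d - 1` whose entry `1` is in or to the right of column `c`. -/
def rowsIn (π : Equiv.Perm (Fin (m + 1))) (c : ℕ) (k d : Fin (m + 1)) : Finset (Fin (m + 1)) :=
  univ.filter fun f => k ≤ f ∧ f < d ∧ c ≤ (π f : ℕ)

theorem mem_rowsIn {c : ℕ} {k d f : Fin (m + 1)} :
    f ∈ rowsIn π c k d ↔ k ≤ f ∧ f < d ∧ c ≤ (π f : ℕ) := by
  simp [rowsIn]

/-- The entries `1` of the given rows. -/
def ones (π : Equiv.Perm (Fin (m + 1))) (K : Finset (Fin (m + 1))) : Finset (Cell m) :=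
  K.image fun f => (f, π f)

theorem image_one_image (K : Finset (Fin (m + 1))) : (K.image π).image (one π) = ones π K := by
  rw [image_image]
  exact image_congr fun f _ => by simp [one]

theorem card_ones (K : Finset (Fin (m + 1))) : (ones π K).card = K.card :=
  card_image_of_injective _ fun _ _ h => congrArg Prod.fst h

variable (F : Type*) [Field F]

theorem wn_ne_zero {k b : Fin (m + 1)} (h : IsNz π (k, b)) : wn F π k b ≠ 0 := by
  simp only [wn, Matrix.of_apply, nvar]
  split_ifs with h1 h2
  · rw [Ne, IsFractionRing.to_map_eq_zero_iff]
    exact MvPolynomial.X_ne_zero _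
  · exact one_ne_zero
  · rcases h with h | h
    · exact (h2 h).elim
    · exact (h1 h).elim

theorem rho_apply (f : Fin (m + 1)) : rho F π (π f) = segProd F π f (Fin.last m) := by
  simp [rho, segProd, Fin.le_last]

theorem rho_ne_zero (μ : Fin (m + 1)) : rho F π μ ≠ 0 :=
  prod_ne_zero_iff.2 fun _ hb => wn_ne_zero F (isNz_iff.2 (mem_rowSupport.1 hb))

/-- The signed, normalized path sum from the rightmost column, with first steps to the left, to the
entries `1` in the rows `k, …, d - 1` in or to the right of column `c`. -/
def leftSum (π : Equiv.Perm (Fin (m + 1))) (c : ℕ) (k d : Fin (m + 1)) : RatFun F π :=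
  (-1) ^ (rowsIn π c k d).card *
    pathSum F π (StepCut π 0) (((insert d (rowsIn π c k d)).erase k).image lastCell)
      (ones π (rowsIn π c k d)) / ∏ f ∈ rowsIn π c k d, rho F π (π f)

/-- For `k = d` the only candidate origin is the erased one, so the sum consists of the empty
system. -/
theorem leftSum_self (c : ℕ) (k : Fin (m + 1)) : leftSum F π c k k = 1 := by
  have : rowsIn π c k k = ∅ := by
    ext f
    simp only [mem_rowsIn, notMem_empty, iff_false]
    exact fun h => absurd h.2.1 (not_lt.2 h.1)
  simp [leftSum, this, ones, pathSum_empty]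

/-- If the `1` of row `k` is to the left of column `c`, erasing `k` removes no origin and there is
one origin too many. -/
theorem leftSum_eq_zero {c : ℕ} {k d : Fin (m + 1)} (hkd : k < d) (hc : (π k : ℕ) < c) :
    leftSum F π c k d = 0 := by
  have hk : k ∉ insert d (rowsIn π c k d) := by
    simp only [mem_insert, mem_rowsIn, not_or]
    exact ⟨hkd.ne, fun h => absurd hc (not_lt.2 h.2.2)⟩
  rw [leftSum, pathSum_eq_zero_of_card_ne, mul_zero, zero_div]
  rw [card_ones, erase_eq_of_notMem hk, card_image_of_injective _ lastCell_injective,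
    card_insert_of_notMem (by simp [mem_rowsIn])]
  omega

theorem rowsIn_eq_insert {k e d : Fin (m + 1)} (hke : k ≤ e) (hed : e < d) :
    rowsIn π (π e) k d = insert e (rowsIn π (π e + 1) k d) := by
  ext f
  simp only [mem_insert, mem_rowsIn]
  constructor
  · rintro ⟨h1, h2, h3⟩
    by_cases hfe : f = e
    · exact Or.inl hfe
    · have : (π f : ℕ) ≠ π e := fun h => hfe (π.injective (Fin.ext h))
      exact Or.inr ⟨h1, h2, by omega⟩
  · rintro (rfl | ⟨h1, h2, h3⟩)
    · exact ⟨hke, hed, le_rfl⟩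
    · exact ⟨h1, h2, by omega⟩

/-- Lowering the threshold from `π e + 1` to `π e` adds exactly the destination `1_{π e}`. The
exchange identity at row `e`, with `K₂` and `d` below and `K₁` above, is divided by the products of
the `ρ`; `segProd` at the rightmost entry is `ρ(1_{π e})`, and the alternating sign turns its term
into the sum with the higher threshold. -/
theorem leftSum_succ {k e d : Fin (m + 1)} (hk : π.symm (Fin.last m) < k) (hke : k ≤ e)
    (hed : e < d) :
    leftSum F π (π e) k d =
      leftSum F π (π e + 1) k d + leftSum F π (π e + 1) k e * leftSum F π (π e) e d := by
  rcases hke.eq_or_lt with rfl | hlt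
  · rw [leftSum_self, leftSum_eq_zero F hed (Nat.lt_succ_self _)]
    ring
  set K₁ := rowsIn π (π e + 1) k e with hK₁
  set K₂ := rowsIn π (π e + 1) e d with hK₂
  have h₁ : ∀ f ∈ K₁, k ≤ f ∧ f < e ∧ (π e : ℕ) + 1 ≤ π f := fun f hf => mem_rowsIn.1 hf
  have h₂ : ∀ f ∈ K₂, e < f ∧ f < d ∧ (π e : ℕ) + 1 ≤ π f := by
    intro f hf
    obtain ⟨h1, h2, h3⟩ := mem_rowsIn.1 hf
    refine ⟨lt_of_le_of_ne h1 ?_, h2, h3⟩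
    rintro rfl
    omega
  have hK : rowsIn π (π e + 1) k d = K₂ ∪ K₁ := by
    ext f
    simp only [hK₁, hK₂, mem_union, mem_rowsIn]
    constructor
    · rintro ⟨h1, h2, h3⟩
      rcases lt_or_ge f e with h | h
      · exact Or.inr ⟨h1, h, h3⟩
      · exact Or.inl ⟨h, h2, h3⟩
    · rintro (⟨h1, h2, h3⟩ | ⟨h1, h2, h3⟩)
      · exact ⟨hke.trans h1, h2, h3⟩
      · exact ⟨h1, h2.trans hed, h3⟩
  have hdisj : Disjoint K₂ K₁ := disjoint_left.2 fun f hf hf' =>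
    absurd (h₁ f hf').2.1 (not_lt.2 (h₂ f hf).1.le)
  have heK₁ : e ∉ K₁ := fun h => lt_irrefl _ (h₁ e h).2.1
  have heK₂ : e ∉ K₂ := fun h => lt_irrefl _ (h₂ e h).1
  have hdK₂ : d ∉ K₂ := fun h => lt_irrefl _ (h₂ d h).2.1
  have hkK₂ : k ∉ K₂ := fun h => absurd (h₂ k h).1 (not_lt.2 hke)
  have hkd : k ≠ d := (hlt.trans hed).ne
  have hex := pathSum_exchange F (r := StepCut π 0) StepCut.step StepCut.of_row
    (e := e) (o := Fin.last m) (isNz_last.2 (hk.le.trans hke)) (fun b _ => Fin.le_last b)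
    (A' := (K₁.erase k).image lastCell) (B' := ones π K₁)
    (by
      intro a ha
      obtain ⟨f, hf, rfl⟩ := mem_image.1 ha
      exact (h₁ f (mem_of_mem_erase hf)).2.1)
    (by
      intro a ha
      obtain ⟨f, hf, rfl⟩ := mem_image.1 ha
      exact (h₁ f hf).2.1)
    (by
      intro a ha
      obtain ⟨f, hf, rfl⟩ := mem_image.1 ha
      exact Fin.le_def.2 ((Nat.le_succ _).trans (h₁ f hf).2.2))
    ((insert d K₂).image lastCell) (ones π K₂)
    (by
      intro a ha
      obtain ⟨f, hf, rfl⟩ := mem_image.1 ha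
      rcases mem_insert.1 hf with rfl | hf
      · exact hed
      · exact (h₂ f hf).1)
    (by
      intro a ha
      obtain ⟨f, hf, rfl⟩ := mem_image.1 ha
      exact (h₂ f hf).1)
    (by
      intro a ha
      obtain ⟨f, hf, rfl⟩ := mem_image.1 ha
      exact Fin.le_def.2 ((Nat.le_succ _).trans (h₂ f hf).2.2))
    (by
      rw [card_ones, card_image_of_injective _ lastCell_injective, card_insert_of_notMem hdK₂])
  have e₁ : ((insert d (rowsIn π (π e) k d)).erase k).image lastCell =
      (insert d K₂).image lastCell ∪ insert (e, Fin.last m) ((K₁.erase k).image lastCell) := by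
    rw [show ((e, Fin.last m) : Cell m) = lastCell e from rfl, ← image_insert, ← image_union,
      rowsIn_eq_insert hke hed, hK]
    congr 1
    ext f
    simp only [mem_erase, mem_insert, mem_union]
    constructor
    · tauto
    · rintro ((rfl | h) | (rfl | h))
      · exact ⟨hkd.symm, Or.inl rfl⟩
      · exact ⟨fun h' => hkK₂ (h' ▸ h), by tauto⟩
      · exact ⟨hlt.ne', by tauto⟩
      · exact ⟨h.1, by tauto⟩
  have e₂ : ((insert d (K₂ ∪ K₁)).erase k).image lastCell =
      (insert d K₂).image lastCell ∪ (K₁.erase k).image lastCell := by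
    rw [← image_union]
    congr 1
    ext f
    simp only [mem_erase, mem_insert, mem_union]
    constructor
    · tauto
    · rintro ((rfl | h) | h)
      · exact ⟨hkd.symm, Or.inl rfl⟩
      · exact ⟨fun h' => hkK₂ (h' ▸ h), by tauto⟩
      · exact ⟨h.1, by tauto⟩
  have e₃ : ((insert e K₁).erase k).image lastCell =
      insert (e, Fin.last m) ((K₁.erase k).image lastCell) := by
    rw [erase_insert_of_ne hlt.ne', image_insert]
    rfl
  have e₄ : ((insert d (insert e K₂)).erase e).image lastCell = (insert d K₂).image lastCell := by
    rw [insert_comm, erase_insert (by simp [hed.ne, heK₂])]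
  have o₁ : ones π (insert e (K₂ ∪ K₁)) = ones π K₂ ∪ insert (e, π e) (ones π K₁) := by
    rw [ones, ones, ones, image_insert, image_union, union_insert]
  have o₂ : ones π (K₂ ∪ K₁) = ones π K₂ ∪ ones π K₁ := image_union _ _
  have o₄ : ones π (insert e K₂) = insert (e, π e) (ones π K₂) := image_insert _ _ _
  have heK : e ∉ K₂ ∪ K₁ := by simp [heK₁, heK₂]
  rw [leftSum, leftSum, leftSum, leftSum, e₁, rowsIn_eq_insert hke hed,
    rowsIn_eq_insert le_rfl hed, hK, ← hK₁, ← hK₂, e₂, e₃, e₄, o₁, o₂, o₄,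
    card_insert_of_notMem heK, card_insert_of_notMem heK₂, card_union_of_disjoint hdisj,
    prod_insert heK, prod_insert heK₂, prod_union hdisj]
  rw [← rho_apply] at hex
  have hρ := rho_ne_zero F (π := π) (π e)
  have hp₁ : ∏ f ∈ K₁, rho F π (π f) ≠ 0 := prod_ne_zero_iff.2 fun f _ => rho_ne_zero F _
  have hp₂ : ∏ f ∈ K₂, rho F π (π f) ≠ 0 := prod_ne_zero_iff.2 fun f _ => rho_ne_zero F _
  rw [eq_sub_of_add_eq hex]
  simp only [pow_add, pow_one]
  field_simp
  ring

/-- Descending induction on the threshold `c`, starting to the right of all columns, where both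
sides are zero. Passing column `c` adds the summand of the row `e` with `π e = c`. -/
theorem leftSum_eq_sum {k d : Fin (m + 1)} (hk : π.symm (Fin.last m) < k) (hkd : k < d) (c : ℕ) :
    leftSum F π c k d =
      ∑ e ∈ rowsIn π c k d, leftSum F π (π e + 1) k e * leftSum F π (π e) e d := by
  by_cases hc : m + 1 ≤ c
  · rw [leftSum_eq_zero F hkd (by omega), sum_eq_zero]
    intro e he
    have := (mem_rowsIn.1 he).2.2
    omega
  induction hn : m + 1 - c generalizing c with
  | zero => omega
  | succ n ih =>
    have hsucc : leftSum F π (c + 1) k d = ∑ e ∈ rowsIn π (c + 1) k d,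
        leftSum F π (π e + 1) k e * leftSum F π (π e) e d := by
      by_cases hc' : m + 1 ≤ c + 1
      · rw [leftSum_eq_zero F hkd (by omega), sum_eq_zero]
        intro e he
        have := (mem_rowsIn.1 he).2.2
        omega
      · exact ih (c + 1) hc' (by omega)
    obtain ⟨e, he⟩ := π.surjective ⟨c, by omega⟩
    have hce : c = (π e : ℕ) := by rw [he]
    subst hce
    by_cases h : k ≤ e ∧ e < d
    · rw [leftSum_succ F hk h.1 h.2, rowsIn_eq_insert h.1 h.2,
        sum_insert (by simp [mem_rowsIn]), hsucc, add_comm]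
    -- The row of the `1` in column `c` lies outside the range from `k` to `d - 1`, so this
    -- threshold changes nothing.
    · have : rowsIn π (π e) k d = rowsIn π (π e + 1) k d := by
        ext f
        simp only [mem_rowsIn]
        refine and_congr_right fun h1 => and_congr_right fun h2 => ?_
        have : (π f : ℕ) ≠ π e := fun h' => h (by
          have := π.injective (Fin.ext h')
          subst this
          exact ⟨h1, h2⟩)
        omega
      rw [leftSum, this, ← leftSum, hsucc]

end LeftSums

/-! ### The column coefficients -/

section Coefficients

open scoped Classical

variable {m : ℕ} {π : Equiv.Perm (Fin (m + 1))}

theorem isChain_stepCut_of_lt {p : List (Cell m)} (hp : p.IsChain (Step π)) {c : Cell m}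
    (hc : p.head? = some c) (h : c.2 ≠ Fin.last m) (t : ℕ) : p.IsChain (StepCut π t) := by
  induction p generalizing c with
  | nil => simp
  | cons a l ih =>
    simp only [List.head?_cons, Option.some.injEq] at hc
    subst hc
    rcases l with _ | ⟨b, l⟩
    · simp
    · obtain ⟨h1, h2⟩ := List.isChain_cons_cons.1 hp
      refine List.isChain_cons_cons.2 ⟨⟨h1, fun h3 => h h3.2.1⟩, ih h2 rfl ?_⟩
      exact ((h1.col_le).trans_lt (lt_of_le_of_ne (Fin.le_last _) h)).ne

/-- A path outside the rightmost column never returns to it. Requiring a left start in that column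
therefore excludes precisely the paths with an upward step in it. -/
theorem pathsL_eq (A B : Finset (Cell m)) :
    pathsL π A B = pathsRel π (StepCut π 0) A B := by
  refine filter_congr fun P _ => forall₂_congr fun p _ => ?_
  obtain ⟨l, hl⟩ := p
  rcases l with _ | ⟨a, _ | ⟨b, l⟩⟩
  · exact (hl.1 rfl).elim
  · simp [Path.Nontrivial]
  · obtain ⟨h1, h2⟩ := List.isChain_cons_cons.1 hl.2.2
    have hsl : Path.StartsLeft (⟨a :: b :: l, hl⟩ : Path π) ↔ b.1 = a.1 := by
      constructor
      · rintro ⟨c, c', l', h, h'⟩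
        simp only [List.cons.injEq] at h
        rw [h.1, h.2.1, h']
      · exact fun h => ⟨a, b, l, rfl, h⟩
    rw [hsl]
    simp only [Path.Nontrivial, List.length_cons, Path.origin, List.head_cons]
    rw [List.isChain_cons_cons]
    constructor
    · intro h
      by_cases ha : a.2 = Fin.last m
      · have h3 := h (by omega) ha
        have hb : b.2 ≠ Fin.last m := by
          intro hb
          exact (Step.lt π h1).ne (Prod.ext h3 (hb.trans ha.symm))
        exact ⟨StepCut.of_row _ _ h1 h3, isChain_stepCut_of_lt h2 rfl hb 0⟩
      · refine ⟨⟨h1, fun h3 => ha h3.2.1⟩, isChain_stepCut_of_lt h2 rfl ?_ 0⟩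
        exact ((h1.col_le).trans_lt (lt_of_le_of_ne (Fin.le_last _) ha)).ne
    · rintro ⟨h3, -⟩ - ha
      rcases h1.2.2 with ⟨h4, -⟩ | ⟨h4, -⟩
      · exact (h3.2 ⟨h4, ha, Nat.zero_le _⟩).elim
      · exact h4

theorem gam_eq {k : Fin (m + 1)} (hk : π.symm (Fin.last m) ≤ k) : gam π (π k) = lastCell k := by
  simp only [gam, lastCell, Equiv.symm_apply_apply]
  refine Prod.ext (by simp) ?_
  refine le_antisymm (Fin.le_last _) (le_max' _ _ (mem_rowSupport.2 ⟨Fin.le_last _, by simpa⟩))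

theorem gam_fst (μ : Fin (m + 1)) : (gam π μ).1 = π.symm μ := rfl

theorem mem_dests {a b μ : Fin (m + 1)} :
    μ ∈ dests π a b ↔ b ≤ μ ∧ π.symm b ≤ π.symm μ ∧ π.symm μ ≤ π.symm a := by
  simp [dests]

theorem mem_image_perm {K : Finset (Fin (m + 1))} {μ : Fin (m + 1)} :
    μ ∈ K.image π ↔ π.symm μ ∈ K := by
  rw [mem_image]
  constructor
  · rintro ⟨f, hf, rfl⟩
    simpa
  · exact fun h => ⟨_, h, by simp⟩

theorem image_gam {K : Finset (Fin (m + 1))} (hK : ∀ f ∈ K, π.symm (Fin.last m) ≤ f) :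
    (K.image π).image (gam π) = K.image lastCell := by
  rw [image_image]
  exact image_congr fun f hf => gam_eq (hK f hf)

variable (F : Type*) [Field F]

/-- Below `1_r` every row has a nonzero entry in the rightmost column, so all origins lie there. The
minus sign comes from the exponent `|D| - 1` in `R_L` against `|D|` in `leftSum`. -/
theorem RL_eq {d j : Fin (m + 1)} (hR : π.symm (Fin.last m) < π.symm j) (hd : π.symm j < d)
    (hj : π d < j) : RL F π (π d) j = - leftSum F π j (π.symm j) d := by
  have hD : dests π (π d) j = (rowsIn π j (π.symm j) d).image π := by
    ext μ
    rw [mem_dests, mem_image_perm, mem_rowsIn]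
    simp only [Equiv.symm_apply_apply, Equiv.apply_symm_apply]
    constructor
    · rintro ⟨h1, h2, h3⟩
      refine ⟨h2, lt_of_le_of_ne h3 ?_, h1⟩
      intro h
      rw [← h, Equiv.apply_symm_apply] at hj
      exact absurd hj (not_lt.2 h1)
    · rintro ⟨h1, h2, h3⟩
      exact ⟨h3, h1, h2.le⟩
  have hrow : ∀ f ∈ rowsIn π j (π.symm j) d, π.symm (Fin.last m) ≤ f := fun f hf =>
    hR.le.trans (mem_rowsIn.1 hf).1
  have hO : origins π (π d) j =
      ((insert d (rowsIn π j (π.symm j) d)).erase (π.symm j)).image lastCell := by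
    rw [origins, hD, erase_insert_of_ne hd.ne', image_insert, gam_eq (hR.le.trans hd.le)]
    congr 1
    have : ((rowsIn π j (π.symm j) d).image π).erase j =
        ((rowsIn π j (π.symm j) d).erase (π.symm j)).image π := by
      rw [image_erase π.injective, Equiv.apply_symm_apply]
    rw [this, image_gam]
    exact fun f hf => hrow f (mem_of_mem_erase hf)
  have hcard : 1 ≤ (rowsIn π j (π.symm j) d).card :=
    card_pos.2 ⟨π.symm j, mem_rowsIn.2 ⟨le_rfl, hd, by simp⟩⟩
  rw [RL, Rgen, pathsL_eq, hO, hD, image_one_image, card_image_of_injective _ π.injective,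
    prod_image (fun _ _ _ _ h => π.injective h), leftSum, pathSum]
  obtain ⟨n, hn⟩ := Nat.exists_eq_add_of_le hcard
  rw [hn, Nat.add_sub_cancel_left, pow_add]
  ring

theorem wn_of_not_nz {k b : Fin (m + 1)} (h : ¬ IsNz π (k, b)) : wn F π k b = 0 :=
  wn_eq_zero F (c := (k, b)) h

theorem wn_one (k : Fin (m + 1)) : wn F π k (π k) = 1 := by
  simp [wn, nvar, Inv]

theorem wu_of_not_nz {k b : Fin (m + 1)} (h : ¬ IsNz π (k, b)) : wu F π k b = 0 := by
  rw [wu, Matrix.of_apply, if_neg (fun h' => h (Or.inr h')), wn_of_not_nz F h]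

theorem wu_one (k : Fin (m + 1)) : wu F π k (π k) = 1 := by
  rw [wu, Matrix.of_apply, if_neg (by simp [isFree_iff]), wn_one]

theorem xL_of_not_nz {k b : Fin (m + 1)} (h : ¬ IsNz π (k, b)) : xL F π k b = 0 := by
  rw [xL, if_neg (fun h' => h (Or.inr h')), wu_of_not_nz F h]

theorem xL_one (k : Fin (m + 1)) : xL F π k (π k) = 1 := by
  rw [xL, if_neg (by simp [isFree_iff]), wu_one]

theorem xL_eq_leftSum {d e : Fin (m + 1)} (hR : π.symm (Fin.last m) < e) (hed : e < d)
    (h : π d < π e) : xL F π d (π e) = - leftSum F π (π e) e d := by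
  rw [xL, if_pos (isFree_iff.2 ⟨h, by simpa⟩), RL_eq F (by simpa) (by simpa) h,
    Equiv.symm_apply_apply]

/-- The rows `k` below `1_j` and `1_r` with `π (k - 1) ≤ j < π k`. -/
def jumpRows (π : Equiv.Perm (Fin (m + 1))) (j : Fin (m + 1)) : Finset (Fin (m + 1)) :=
  univ.filter fun k => π.symm j < k ∧ π.symm (Fin.last m) < k ∧ j < π k ∧
    ∃ k' : Fin (m + 1), (k' : ℕ) + 1 = k ∧ π k' ≤ j

theorem mem_jumpRows {j k : Fin (m + 1)} : k ∈ jumpRows π j ↔ π.symm j < k ∧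
    π.symm (Fin.last m) < k ∧ j < π k ∧ ∃ k' : Fin (m + 1), (k' : ℕ) + 1 = k ∧ π k' ≤ j := by
  simp [jumpRows]

/-- The rightmost cell of the row above a destination fails to be an origin exactly when the `1` of
that row is in or to the left of column `j`; column `j` itself counts because `1_j` contributes no
origin of its own. -/
theorem dests1_eq {j : Fin (m + 1)} (hj : π (Fin.last m) < j) (hjl : j < Fin.last m) :
    dests1 π (π (Fin.last m)) j = (jumpRows π j).image π := by
  ext μ
  rw [mem_image_perm, mem_jumpRows, Equiv.apply_symm_apply, dests1, mem_filter]
  constructor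
  · rintro ⟨-, c, hc, hcμ⟩
    obtain ⟨hcO, hc2, hc1, k', hk'c, hfree, hnO⟩ := mem_filter.1 hc
    rw [Equiv.symm_apply_apply] at hc1
    rcases mem_insert.1 hcO with rfl | hcO
    · rw [gam_fst, Equiv.symm_apply_apply] at hc1
      exact absurd hc1 (lt_irrefl _)
    obtain ⟨ν, hν, rfl⟩ := mem_image.1 hcO
    rw [gam_fst] at hcμ
    have hνμ := π.symm.injective hcμ
    subst hνμ
    obtain ⟨hνj, hνd⟩ := mem_erase.1 hν
    obtain ⟨h1, h2, h3⟩ := mem_dests.1 hνd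
    rw [gam_fst] at hk'c
    have hfr := isFree_iff.1 hfree
    have h4 : π.symm j < π.symm ν :=
      lt_of_le_of_ne h2 fun h => hνj (π.symm.injective h).symm
    refine ⟨h4, ?_, lt_of_le_of_ne h1 (Ne.symm hνj), k', hk'c, ?_⟩
    · refine Fin.lt_def.2 ?_
      have := Fin.lt_def.1 hfr.2
      omega
    · by_contra hcon
      rw [not_le] at hcon
      refine hnO (mem_insert_of_mem (mem_image.2 ⟨π k', ?_, gam_eq hfr.2.le⟩))
      refine mem_erase.2 ⟨hcon.ne', mem_dests.2 ⟨hcon.le, ?_, ?_⟩⟩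
      · rw [Equiv.symm_apply_apply]
        have := Fin.lt_def.1 h4
        exact Fin.le_def.2 (by omega)
      · rw [Equiv.symm_apply_apply, Equiv.symm_apply_apply]
        exact Fin.le_last _
  · rintro ⟨h1, h2, h3, k', hk', hk'j⟩
    have hd : μ ∈ dests π (π (Fin.last m)) j :=
      mem_dests.2 ⟨h3.le, h1.le, by rw [Equiv.symm_apply_apply]; exact Fin.le_last _⟩
    have hg : gam π μ = lastCell (π.symm μ) := by
      have := gam_eq (π := π) h2.le
      rwa [Equiv.apply_symm_apply] at this
    have hlt : π.symm μ < Fin.last m := by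
      refine lt_of_le_of_ne (Fin.le_last _) fun h => ?_
      rw [← h, Equiv.apply_symm_apply] at hj
      exact lt_asymm hj h3
    refine ⟨hd, gam π μ, mem_filter.2 ⟨mem_insert_of_mem (mem_image_of_mem _
      (mem_erase.2 ⟨h3.ne', hd⟩)), by rw [hg]; rfl, by rwa [gam_fst, Equiv.symm_apply_apply],
      k', by rw [gam_fst]; exact hk', ?_, ?_⟩, rfl⟩
    · refine isFree_iff.2 ⟨hk'j.trans_lt hjl, lt_of_le_of_ne ?_ ?_⟩
      · have := Fin.lt_def.1 h2
        exact Fin.le_def.2 (by omega)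
      · rintro rfl
        rw [Equiv.apply_symm_apply] at hk'j
        exact absurd hjl (not_lt.2 hk'j)
    · intro hO
      rcases mem_insert.1 hO with h | h
      · have := congrArg Prod.fst h
        rw [gam_fst, Equiv.symm_apply_apply] at this
        have h5 := Fin.lt_def.1 hlt
        have h6 : (k' : ℕ) = (Fin.last m : Fin (m + 1)) := congrArg Fin.val this
        omega
      · obtain ⟨ν, hν, hνk⟩ := mem_image.1 h
        have h5 : π.symm ν = k' := congrArg Prod.fst hνk
        obtain ⟨h6, h7⟩ := mem_erase.1 hν
        rw [← h5, Equiv.apply_symm_apply] at hk'j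
        exact h6 (le_antisymm hk'j (mem_dests.1 h7).1)

/-- The common factor of the summands of the coefficients `Q_j(l)` that belong to row `k`. -/
def jumpCoeff (π : Equiv.Perm (Fin (m + 1))) (j k : Fin (m + 1)) : RatFun F π :=
  nvar F π (π k) (Fin.last m) * wuAbove F π k j

theorem PLstar_eq (A B : Finset (Cell m)) :
    PLstar F π A B = pathSum F π (StepCut π 0) A B := by
  rw [PLstar]
  split_ifs with h
  · rw [h.1, h.2, pathSum_empty]
  · rw [PL, pathsL_eq, pathSum]

/-- The summands of `Q_j(l)` are rewritten as `leftSum`. The condition that `1_{π k}` equals `1_l`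
or lies above and to the right of it can be relaxed to `k ≤ π⁻¹ l`, as the additional summands are
zero. -/
theorem Q_eq {j l : Fin (m + 1)} (hj : π (Fin.last m) < j) (hjl : j < l)
    (hl : j < Fin.last m) :
    Q F π j l = ∑ k ∈ jumpRows π j, if k ≤ π.symm l then
      jumpCoeff F π j k * leftSum F π (l + 1) k (π.symm l) else 0 := by
  have hD0 : D0 π j l =
      ((jumpRows π j).filter fun k => π k ∈ destsNE π l (π (Fin.last m)) j).image π := by
    ext μ
    rw [D0, dests1_eq hj hl, mem_inter, mem_image_perm, mem_image_perm, mem_filter,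
      Equiv.apply_symm_apply]
  have hdl : ∀ μ, j ≤ μ → π.symm j ≤ π.symm μ → μ ∈ dests π (π (Fin.last m)) j := fun μ h1 h2 =>
    mem_dests.2 ⟨h1, h2, by rw [Equiv.symm_apply_apply]; exact Fin.le_last _⟩
  rw [Q, hD0, sum_image (fun _ _ _ _ h => π.injective h), sum_filter]
  refine sum_congr rfl fun k hk => ?_
  obtain ⟨hk1, hk2, hk3, -⟩ := mem_jumpRows.1 hk
  rw [Equiv.symm_apply_apply]
  by_cases hkl : k ≤ π.symm l
  swap
  · rw [if_neg hkl, if_neg]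
    intro h
    obtain ⟨-, h⟩ := mem_filter.1 h
    rw [Equiv.symm_apply_apply] at h
    rcases h with h | h
    · exact hkl (by rw [← h, Equiv.symm_apply_apply])
    · exact hkl h.1.le
  rw [if_pos hkl]
  have hD2 : D2 π j l k = (rowsIn π (l + 1) k (π.symm l)).image π := by
    ext μ
    rw [D2, mem_inter, mem_erase, destsNE, destsDown, mem_filter, mem_filter, mem_image_perm,
      mem_rowsIn, Equiv.apply_symm_apply]
    constructor
    · rintro ⟨⟨h1, -, h2⟩, -, h3⟩
      have h4 := h2.resolve_left h1
      exact ⟨h3, h4.1, h4.2⟩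
    · rintro ⟨h1, h2, h3⟩
      have h4 : l < μ := h3
      have h5 := hdl μ (hjl.trans h4).le (hk1.le.trans h1)
      exact ⟨⟨h4.ne', h5, Or.inr ⟨h2, h4⟩⟩, h5, h1⟩
  have hO2 : O2 π j l k =
      ((insert (π.symm l) (rowsIn π (l + 1) k (π.symm l))).erase k).image lastCell := by
    rw [O2, hD2, image_gam (fun f hf => hk2.le.trans (mem_rowsIn.1 hf).1),
      image_erase lastCell_injective, image_insert]
    rfl
  have hterm : (-1) ^ (D2 π j l k).card * nvar F π (π k) (Fin.last m) * wuAbove F π k j *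
      (PLstar F π (O2 π j l k) ((D2 π j l k).image (one π)) / ∏ μ ∈ D2 π j l k, rho F π μ) =
      jumpCoeff F π j k * leftSum F π (l + 1) k (π.symm l) := by
    rw [PLstar_eq, hO2, hD2, image_one_image, card_image_of_injective _ π.injective,
      prod_image (fun _ _ _ _ h => π.injective h), leftSum, jumpCoeff]
    ring
  rw [hterm]
  split_ifs with h
  · rfl
  · rcases hkl.eq_or_lt with rfl | hlt
    · refine (h (mem_filter.2 ⟨hdl _ hk3.le (by simpa using hk1.le), Or.inl (by simp)⟩)).elim
    · rw [leftSum_eq_zero F hlt, mul_zero]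
      have h6 : ¬ l < π k := fun h' =>
        h (mem_filter.2 ⟨hdl _ hk3.le (by simpa using hk1.le), Or.inr ⟨by simpa, h'⟩⟩)
      have := Fin.le_def.1 (not_lt.1 h6)
      omega

/-- The sum over the columns of the products with the entries `x^L_d(l)`, by rows of the entries
`1_l`. -/
theorem sum_Q_mul_xL {d j : Fin (m + 1)} (hj : π (Fin.last m) < j) (hl : j < Fin.last m) :
    ∑ l ∈ Ioo j (Fin.last m), Q F π j l * xL F π d l =
      ∑ k ∈ jumpRows π j, jumpCoeff F π j k *
        ∑ e ∈ univ.filter (fun e => k ≤ e ∧ j < π e),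
          leftSum F π (π e + 1) k e * xL F π d (π e) := by
  rw [sum_congr rfl fun l h => by rw [Q_eq F hj (mem_Ioo.1 h).1 hl, sum_mul], sum_comm]
  refine sum_congr rfl fun k hk => ?_
  obtain ⟨hk1, hk2, hk3, -⟩ := mem_jumpRows.1 hk
  rw [mul_sum]
  rw [sum_congr rfl fun l _ => by rw [ite_mul, zero_mul], ← sum_filter]
  refine sum_bij' (fun l _ => π.symm l) (fun e _ => π e) ?_ ?_ ?_ ?_ ?_
  · intro l hl'
    obtain ⟨h1, h2⟩ := mem_filter.1 hl'
    exact mem_filter.2 ⟨mem_univ _, h2, by simpa using (mem_Ioo.1 h1).1⟩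
  · intro e he
    obtain ⟨-, h1, h2⟩ := mem_filter.1 he
    refine mem_filter.2 ⟨mem_Ioo.2 ⟨h2, lt_of_le_of_ne (Fin.le_last _) ?_⟩, by simpa⟩
    -- The column `r` does not occur: its `1` is above row `k`, hence above row `e`.
    intro h
    rw [← h, Equiv.symm_apply_apply] at hk2
    exact absurd hk2 (not_lt.2 h1)
  · intro l _
    simp
  · intro e _
    simp
  · intro l _
    simp only [Equiv.apply_symm_apply]
    ring

/-- For `e < d` the factor `x^L_d(π e)` is a negative `leftSum` and for `e > d` it is zero, so the
sum is the composition law with threshold `j + 1`, negated. -/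
theorem sum_leftSum_mul_xL_of_lt {d j k : Fin (m + 1)} (hk : π.symm (Fin.last m) < k)
    (hd : π d < j) :
    ∑ e ∈ univ.filter (fun e => k ≤ e ∧ j < π e), leftSum F π (π e + 1) k e * xL F π d (π e) =
      if k < d then - leftSum F π (j + 1) k d else 0 := by
  have hz : ∀ e, d < e → xL F π d (π e) = 0 := fun e he =>
    xL_of_not_nz F fun h => absurd he (not_lt.2 (by simpa using (isNz_iff.1 h).2))
  split_ifs with hkd
  · rw [leftSum_eq_sum F hk hkd, ← sum_neg_distrib]
    symm
    refine sum_subset_zero_on_sdiff ?_ ?_ ?_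
    · intro e he
      obtain ⟨h1, h2, h3⟩ := mem_rowsIn.1 he
      exact mem_filter.2 ⟨mem_univ _, h1, h3⟩
    · intro e he
      obtain ⟨h1, h2⟩ := mem_sdiff.1 he
      obtain ⟨-, h3, h4⟩ := mem_filter.1 h1
      rw [hz e, mul_zero]
      refine lt_of_le_of_ne (not_lt.1 fun h => h2 (mem_rowsIn.2 ⟨h3, h, h4⟩)) ?_
      rintro rfl
      exact lt_asymm hd h4
    · intro e he
      obtain ⟨h1, h2, h3⟩ := mem_rowsIn.1 he
      rw [xL_eq_leftSum F (hk.trans_le h1) h2 (hd.trans (show j < π e from h3)), mul_neg]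
  · refine sum_eq_zero fun e he => ?_
    obtain ⟨-, h3, h4⟩ := mem_filter.1 he
    rw [hz e, mul_zero]
    refine lt_of_le_of_ne ((not_lt.1 hkd).trans h3) ?_
    rintro rfl
    exact lt_asymm hd h4

/-- For `k < d` the summand `e = d`, where `x^L` is `1`, equals `leftSum (π d + 1) k d`; by the
composition law the remaining summands add up to its negative. -/
theorem sum_leftSum_mul_xL_of_gt {d j k : Fin (m + 1)} (hk : π.symm (Fin.last m) < k)
    (hd : j < π d) :
    ∑ e ∈ univ.filter (fun e => k ≤ e ∧ j < π e), leftSum F π (π e + 1) k e * xL F π d (π e) =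
      if k = d then 1 else 0 := by
  have hz : ∀ e, d < e → xL F π d (π e) = 0 := fun e he =>
    xL_of_not_nz F fun h => absurd he (not_lt.2 (by simpa using (isNz_iff.1 h).2))
  rcases lt_trichotomy k d with hkd | rfl | hkd
  · rw [if_neg hkd.ne]
    have hsub : insert d (rowsIn π (π d + 1) k d) ⊆ univ.filter (fun e => k ≤ e ∧ j < π e) := by
      intro e he
      rcases mem_insert.1 he with rfl | he
      · exact mem_filter.2 ⟨mem_univ _, hkd.le, hd⟩
      · obtain ⟨h1, h2, h3⟩ := mem_rowsIn.1 he
        exact mem_filter.2 ⟨mem_univ _, h1, hd.trans h3⟩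
    rw [← sum_subset hsub, sum_insert (by simp [mem_rowsIn]), xL_one, mul_one,
      leftSum_eq_sum F hk hkd, ← sum_add_distrib]
    · refine sum_eq_zero fun e he => ?_
      obtain ⟨h1, h2, h3⟩ := mem_rowsIn.1 he
      rw [xL_eq_leftSum F (hk.trans_le h1) h2 h3]
      ring
    · intro e he hne
      obtain ⟨-, h3, h4⟩ := mem_filter.1 he
      rw [mem_insert, mem_rowsIn, not_or] at hne
      rcases lt_or_gt_of_ne hne.1 with h | h
      · rw [xL_of_not_nz, mul_zero]
        intro hnz
        have h5 : π d ≤ π e := (isNz_iff.1 hnz).1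
        have h6 : π d ≠ π e := fun h' => hne.1 (π.injective h').symm
        exact hne.2 ⟨h3, h, lt_of_le_of_ne h5 h6⟩
      · rw [hz e h, mul_zero]
  · rw [if_pos rfl, sum_eq_single k, leftSum_self, xL_one, mul_one]
    · intro e he hne
      obtain ⟨-, h3, h4⟩ := mem_filter.1 he
      rw [hz e (lt_of_le_of_ne h3 hne.symm), mul_zero]
    · intro h
      exact (h (mem_filter.2 ⟨mem_univ _, le_rfl, hd⟩)).elim
  · rw [if_neg hkd.ne']
    refine sum_eq_zero fun e he => ?_
    rw [hz e (hkd.trans_le (mem_filter.1 he).2.1), mul_zero]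

end Coefficients

/-! ### Decomposition of `R_1` -/

section BottomLeft

open scoped Classical

variable {m : ℕ} {π : Equiv.Perm (Fin (m + 1))}

/-- A cell of the rightmost column can be entered only from below, and the cut forbids upward steps
there from rows below `k`. -/
theorem not_reach_lastCell {t : ℕ} {k : Fin (m + 1)} (ht : t ≤ k + 1) {a : Cell m}
    (ha : a ≠ lastCell k) : ¬ Relation.ReflTransGen (StepCut π t) a (lastCell k) := by
  intro h
  rcases Relation.ReflTransGen.cases_tail h with h | ⟨x, -, h⟩
  · exact ha h.symm
  · rcases h.1.2.2 with ⟨h1, h2, -⟩ | ⟨-, h2, -⟩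
    · refine h.2 ⟨h1, h1.symm, ?_⟩
      have : k < x.1 := h2
      have := Fin.lt_def.1 this
      omega
    · exact absurd h2 (not_lt.2 (Fin.le_last _))

theorem stepCut_succ_iff {k : Fin (m + 1)} {x y : Cell m} (h : x ≠ lastCell k) :
    StepCut π (k + 1) x y ↔ StepCut π k x y := by
  refine and_congr_right fun _ => not_congr (and_congr_right fun _ => and_congr_right fun h1 => ?_)
  have : (x.1 : ℕ) ≠ k := fun h2 => h (Prod.ext (Fin.ext h2) h1)
  omega

theorem paths_eq (A B : Finset (Cell m)) : paths π A B = pathsRel π (StepCut π (m + 1)) A B := by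
  rw [pathsRel, filter_true_of_mem]
  intro P _ p _
  refine p.2.2.2.imp fun x y h => ⟨h, fun h' => ?_⟩
  have := x.1.2
  omega

variable (F : Type*) [Field F]

theorem pathSum_stepCut_succ_of_notMem {k : Fin (m + 1)} {A : Finset (Cell m)}
    (h : lastCell k ∉ A) (B : Finset (Cell m)) :
    pathSum F π (StepCut π (k + 1)) A B = pathSum F π (StepCut π k) A B := by
  refine pathSum_congr_rel F fun a ha b _ x y hx _ _ => stepCut_succ_iff ?_
  rintro rfl
  exact not_reach_lastCell le_rfl (fun h' => h (h' ▸ ha)) hx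

/-- Allowing the upward step from the rightmost entry of row `k`. -/
theorem pathSum_stepCut_succ {k : Fin (m + 1)} {A : Finset (Cell m)} (h : lastCell k ∈ A)
    (B : Finset (Cell m)) :
    pathSum F π (StepCut π (k + 1)) A B = pathSum F π (StepCut π k) A B +
      ∑ c ∈ univ.filter (fun c => Step π (lastCell k) c ∧ c.2 = Fin.last m ∧ c ∉ A),
        wn F π k (Fin.last m) *
          pathSum F π (StepCut π k) (insert c (A.erase (lastCell k))) B := by
  rw [pathSum_rec F StepCut.step h fun a _ ha => not_reach_lastCell le_rfl ha,
    pathSum_rec F StepCut.step h fun a _ ha => not_reach_lastCell (Nat.le_succ _) ha, add_assoc,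
    pathSum_stepCut_succ_of_notMem F (notMem_erase _ _)]
  congr 1
  -- First steps that leave the rightmost column are the same for both cuts; those that stay in it
  -- are the new contributions. After the first step row `k` of this column is out of reach, so the
  -- old cut may be used again.
  rw [← sum_filter_add_sum_filter_not _ (fun c : Cell m => ¬ c.2 = Fin.last m), filter_filter,
    filter_filter]
  have hins : ∀ c, c ≠ lastCell k → pathSum F π (StepCut π (k + 1))
      (insert c (A.erase (lastCell k))) B =
      pathSum F π (StepCut π k) (insert c (A.erase (lastCell k))) B := fun c hc =>
    pathSum_stepCut_succ_of_notMem F (by simp [hc.symm]) B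
  congr 1
  · refine sum_congr (filter_congr fun c _ => ?_) fun c hc => ?_
    · constructor
      · rintro ⟨⟨h1, h2⟩, h3⟩
        exact ⟨⟨h1.1, fun h4 => h3 (h4.1.trans h4.2.1)⟩, h2⟩
      · rintro ⟨h1, h2⟩
        have h3 : c.2 ≠ Fin.last m := fun h3 => h1.2 ⟨h3, rfl, le_rfl⟩
        exact ⟨⟨⟨h1.1, fun h4 => h3 (h4.1.trans h4.2.1)⟩, h2⟩, h3⟩
    · rw [hins c (Step.lt π (mem_filter.1 hc).2.1.1).ne]
  · refine sum_congr (filter_congr fun c _ => ?_) fun c hc => ?_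
    · rw [not_not]
      constructor
      · rintro ⟨⟨h1, h2⟩, h3⟩
        exact ⟨h1.1, h3, h2⟩
      · rintro ⟨h1, h2, h3⟩
        exact ⟨⟨⟨h1, fun h4 => absurd h4.2.2 (Nat.not_succ_le_self _)⟩, h3⟩, h2⟩
    · rw [hins c (Step.lt π (mem_filter.1 hc).2.1).ne]
      rfl

theorem origins_row_le {a b : Fin (m + 1)} {c : Cell m} (hc : c ∈ origins π a b) :
    c.1 ≤ π.symm a := by
  rcases mem_insert.1 hc with rfl | hc
  · exact le_rfl
  · obtain ⟨ν, hν, rfl⟩ := mem_image.1 hc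
    exact (mem_dests.1 (mem_of_mem_erase hν)).2.2

/-- Once the path from the bottom origin starts left, every other path with origin in the rightmost
column starts above row `d`, so the cut at `d` imposes no further condition. Subtracting the cut at
`0` removes `𝒫_L`. -/
theorem sum_paths1 {d j : Fin (m + 1)} (hR : π.symm (Fin.last m) < d) :
    ∑ P ∈ paths1 π (π d) j, weight F P =
      pathSum F π (StepCut π d) (origins π (π d) j) ((dests π (π d) j).image (one π)) -
        pathSum F π (StepCut π 0) (origins π (π d) j) ((dests π (π d) j).image (one π)) := by
  set A := origins π (π d) j with hA
  set B := (dests π (π d) j).image (one π) with hB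
  have hg : gam π (π d) = lastCell d := gam_eq hR.le
  have hsub : pathsRel π (StepCut π 0) A B ⊆ pathsRel π (StepCut π d) A B := by
    intro P hP
    obtain ⟨h1, h2, h3, h4⟩ := mem_pathsRel.1 hP
    refine mem_pathsRel.2 ⟨h1, h2, h3, fun p hp => (h4 p hp).imp fun x y h => ⟨h.1, fun h5 => ?_⟩⟩
    exact h.2 ⟨h5.1, h5.2.1, Nat.zero_le _⟩
  rw [pathSum, pathSum, eq_sub_iff_add_eq, ← sum_sdiff hsub]
  congr 2
  rw [paths1, ← hA, ← hB, pathsL_eq]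
  ext P
  rw [mem_filter, mem_sdiff, mem_sdiff, and_right_comm]
  refine and_congr_left fun _ => ?_
  rw [pathsRel, mem_filter]
  refine and_congr_right fun hP => ?_
  obtain ⟨hPA, hPB, hd⟩ := (mem_filter.1 hP).2
  constructor
  · rintro ⟨p, hp, hpo, hsl⟩ q hq
    by_cases hqp : q = p
    · subst hqp
      obtain ⟨c, c', l, hql, hcc⟩ := hsl
      have hch := q.2.2.2
      simp only [Path.origin, hql, List.head_cons] at hpo
      rw [hql] at hch ⊢
      obtain ⟨h1, h2⟩ := List.isChain_cons_cons.1 hch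
      refine List.isChain_cons_cons.2 ⟨StepCut.of_row _ _ h1 hcc, isChain_stepCut_of_lt h2 rfl ?_ _⟩
      intro hc'
      rw [hg] at hpo
      exact (Step.lt π h1).ne (Prod.ext hcc (by rw [hc', hpo]; rfl))
    · by_cases hq2 : q.origin.2 = Fin.last m
      · have hqA : q.origin ∈ A := hPA ▸ mem_image_of_mem _ hq
        have h1 : q.origin.1 ≤ d := by simpa using origins_row_le hqA
        have h2 : q.origin.1 ≠ d := by
          intro h2
          refine hqp (eq_of_disjoint hd hq hp q.origin_mem ?_)
          rw [show q.origin = p.origin by rw [hpo, hg]; exact Prod.ext h2 hq2]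
          exact p.origin_mem
        refine (isChain_iff_of_agree (G := Step π) q.2.1 (fun x y hx hxy => ?_) q.2.2.2).1 q.2.2.2
        have h3 : x ≤ q.origin := reflTransGen_le (fun _ _ h => h) hx
        have h4 := Fin.lt_def.1 ((Prod.le_def.1 h3).1.trans_lt (lt_of_le_of_ne h1 h2))
        exact ⟨fun h => ⟨h, fun h5 => by omega⟩, fun h => h.1⟩
      · exact isChain_stepCut_of_lt q.2.2.2 (List.head?_eq_some_head q.2.1) hq2 _
  · intro h
    obtain ⟨p, hp, hpo⟩ := mem_image.1
      (show gam π (π d) ∈ P.image Path.origin by rw [hPA]; exact mem_insert_self _ _)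
    refine ⟨p, hp, hpo, ?_⟩
    have hch := h p hp
    have hdest : p.dest ∈ B := hPB ▸ mem_image_of_mem _ hp
    obtain ⟨l, hl⟩ := p
    rcases l with _ | ⟨a, _ | ⟨b, l⟩⟩
    · exact (hl.1 rfl).elim
    -- A path of length zero at the bottom origin would need the entry `1_r` in row `d`, but `1_r`
    -- is above that row.
    · obtain ⟨μ, -, hμ⟩ := mem_image.1 hdest
      simp only [Path.dest, Path.origin, List.getLast_singleton, List.head_cons] at hμ hpo
      rw [hpo, hg] at hμ
      have h1 : μ = Fin.last m := congrArg Prod.snd hμ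
      have h2 : π.symm μ = d := congrArg Prod.fst hμ
      rw [h1] at h2
      exact absurd hR (by rw [h2]; exact lt_irrefl _)
    · obtain ⟨h1, -⟩ := List.isChain_cons_cons.1 hch
      refine ⟨a, b, l, rfl, ?_⟩
      simp only [Path.origin, List.head_cons] at hpo
      rcases h1.1.2.2 with ⟨h2, -⟩ | ⟨h2, -⟩
      · rw [hpo, hg] at h1 h2
        exact (h1.2 ⟨h2, rfl, le_rfl⟩).elim
      · exact h2

theorem step_lastCell {k k' : Fin (m + 1)} (hk : (k' : ℕ) + 1 = k)
    (hR : π.symm (Fin.last m) ≤ k') : Step π (lastCell k) (lastCell k') := by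
  have hlt : k' < k := Fin.lt_def.2 (by omega)
  refine ⟨isNz_last.2 (hR.trans hlt.le), isNz_last.2 hR, Or.inl ⟨rfl, hlt, fun i h1 h2 => ?_⟩⟩
  have h1 := Fin.lt_def.1 h1
  have h2 := Fin.lt_def.1 h2
  simp only [lastCell] at h1 h2
  omega

theorem eq_of_step_lastCell {k : Fin (m + 1)} {c : Cell m} (h : Step π (lastCell k) c)
    (hc : c.2 = Fin.last m) :
    ∃ k' : Fin (m + 1), c = lastCell k' ∧ (k' : ℕ) + 1 = k ∧ π.symm (Fin.last m) ≤ k' := by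
  obtain ⟨k', b⟩ := c
  simp only at hc
  subst hc
  rcases h.2.2 with ⟨-, h1, h2⟩ | ⟨-, h1, -⟩
  · have hR := isNz_last.1 h.2.1
    refine ⟨k', rfl, ?_, hR⟩
    by_contra hne
    have hlt := Fin.lt_def.1 h1
    simp only [lastCell] at hlt h2
    have hk := k.2
    refine h2 ⟨k' + 1, by omega⟩ (Fin.lt_def.2 (by simp)) (Fin.lt_def.2 (by simp; omega))
      (isNz_last.2 (hR.trans (Fin.le_def.2 (by simp))))
  · exact absurd h1 (lt_irrefl _)

theorem lastCell_mem_origins {d j k : Fin (m + 1)} (hR : π.symm (Fin.last m) ≤ k) (hkd : k ≠ d)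
    (hd : π.symm (Fin.last m) ≤ d) :
    lastCell k ∈ origins π (π d) j ↔ π k ∈ (dests π (π d) j).erase j := by
  rw [origins, mem_insert, gam_eq hd, lastCell_injective.eq_iff, or_iff_right hkd, mem_image]
  constructor
  · rintro ⟨ν, hν, h⟩
    have h1 : π.symm ν = k := congrArg Prod.fst h
    rwa [← h1, Equiv.apply_symm_apply]
  · exact fun h => ⟨_, h, gam_eq hR⟩

/-- Identifies `jumpRows` with the rows at which raising the cut can create new systems,
independently of the entry's row `d > k`. -/
theorem mem_jumpRows_iff {d j k : Fin (m + 1)} (hd : π.symm (Fin.last m) < d) (hkd : k < d) :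
    k ∈ jumpRows π j ↔ lastCell k ∈ origins π (π d) j ∧
      ∃ c, Step π (lastCell k) c ∧ c.2 = Fin.last m ∧ c ∉ origins π (π d) j := by
  rw [mem_jumpRows]
  constructor
  · rintro ⟨h1, h2, h3, k', hk', h4⟩
    have hR' : π.symm (Fin.last m) ≤ k' := by
      have := Fin.lt_def.1 h2
      exact Fin.le_def.2 (by omega)
    have hk'd : k' ≠ d := by
      rintro rfl
      have := Fin.lt_def.1 hkd
      omega
    refine ⟨(lastCell_mem_origins h2.le hkd.ne hd.le).2 (mem_erase.2 ⟨h3.ne', mem_dests.2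
      ⟨h3.le, by simpa using h1.le, by simpa using hkd.le⟩⟩), lastCell k',
      step_lastCell hk' hR', rfl, fun h => ?_⟩
    rw [lastCell_mem_origins hR' hk'd hd.le] at h
    obtain ⟨h5, h6⟩ := mem_erase.1 h
    exact h5 (le_antisymm h4 (mem_dests.1 h6).1)
  · rintro ⟨h1, c, h2, h3, h4⟩
    obtain ⟨k', rfl, hk', hR'⟩ := eq_of_step_lastCell h2 h3
    have hlt : k' < k := Fin.lt_def.2 (by omega)
    rw [lastCell_mem_origins (hR'.trans hlt.le) hkd.ne hd.le] at h1
    rw [lastCell_mem_origins hR' (hlt.trans hkd).ne hd.le] at h4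
    obtain ⟨h5, h6⟩ := mem_erase.1 h1
    obtain ⟨h7, h8, h9⟩ := mem_dests.1 h6
    simp only [Equiv.symm_apply_apply] at h8 h9
    have h10 : π.symm j < k := lt_of_le_of_ne h8 fun h => h5 (by rw [← h]; simp)
    refine ⟨h10, hR'.trans_lt hlt, lt_of_le_of_ne h7 h5.symm, k', hk', ?_⟩
    by_contra hcon
    rw [not_le] at hcon
    refine h4 (mem_erase.2 ⟨hcon.ne', mem_dests.2 ⟨hcon.le, ?_, ?_⟩⟩)
    · rw [Equiv.symm_apply_apply]
      have := Fin.lt_def.1 h10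
      exact Fin.le_def.2 (by omega)
    · simpa using (hlt.trans hkd).le

/-- The only path runs through the whole row to `1_j`, and its weight is `ρ(1_j)`. This lets the
case `π (k - 1) = j`, where the entry above is `1` instead of a free variable, be treated like the
others. -/
theorem R_one (j : Fin (m + 1)) : R F π j j = 1 := by
  have hD : dests π j j = {j} := by
    ext μ
    rw [mem_dests, mem_singleton]
    constructor
    · rintro ⟨-, h2, h3⟩
      exact π.symm.injective (le_antisymm h3 h2)
    · rintro rfl
      simp
  obtain ⟨e, rfl⟩ := π.surjective j
  have hnz : IsNz π (gam π (π e)) := isNz_iff.2 (mem_rowSupport.1 (max'_mem _ _))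
  have hg : gam π (π e) = (e, (gam π (π e)).2) := Prod.ext (by simp [gam_fst]) rfl
  have hs : segProd F π e (gam π (π e)).2 = rho F π (π e) := by
    rw [rho, segProd]
    simp only [Equiv.symm_apply_apply]
    refine prod_congr (filter_true_of_mem fun b hb => ?_) fun _ _ => rfl
    exact le_max' _ _ (by simpa using hb)
  have ho : one π (π e) = (e, π e) := by simp [one]
  rw [R, Rgen, paths_eq, origins, hD, card_singleton, prod_singleton, erase_singleton, image_empty,
    image_singleton, insert_empty_eq, ← pathSum, ho, hg,
    pathSum_segment F StepCut.step StepCut.of_row _ _ (hg ▸ hnz), hs]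
  simp [rho_ne_zero]

theorem wu_eq_R {k j : Fin (m + 1)} (h : IsNz π (k, j)) : wu F π k j = R F π (π k) j := by
  rw [wu, Matrix.of_apply]
  split_ifs with hf
  · rfl
  · rcases h with h | h
    · have h : π k = j := h
      rw [← h, wn_one, R_one]
    · exact (hf h).elim

theorem wuAbove_eq {k k' : Fin (m + 1)} (hk : (k' : ℕ) + 1 = k) (j : Fin (m + 1)) :
    wuAbove F π k j = wu F π k' j := by
  rw [wuAbove, dif_neg (by omega)]
  congr 1
  exact Fin.ext (by simp; omega)

theorem wn_last (k : Fin (m + 1)) : wn F π k (Fin.last m) = nvar F π (π k) (Fin.last m) := rfl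

/-- The contribution of one row to `R_1`. -/
theorem jump_term {d j k k' : Fin (m + 1)} (hd : π.symm (Fin.last m) < d) (hkd : k < d)
    (hdj : π d < j) (hk : k ∈ jumpRows π j) (hk' : (k' : ℕ) + 1 = k) (hk'j : π k' ≤ j) :
    (-1) ^ ((dests π (π d) j).card - 1) *
      (wn F π k (Fin.last m) * pathSum F π (StepCut π k)
        (insert (lastCell k') ((origins π (π d) j).erase (lastCell k)))
        ((dests π (π d) j).image (one π))) / ∏ μ ∈ dests π (π d) j, rho F π μ =
      jumpCoeff F π j k * leftSum F π (j + 1) k d := by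
  obtain ⟨h1, h2, h3, -⟩ := mem_jumpRows.1 hk
  have hlt : k' < k := Fin.lt_def.2 (by omega)
  have hR' : π.symm (Fin.last m) ≤ k' := by
    have := Fin.lt_def.1 h2
    exact Fin.le_def.2 (by omega)
  have hj' : π.symm j ≤ k' := by
    have := Fin.lt_def.1 h1
    exact Fin.le_def.2 (by omega)
  have hle : ∀ x : Fin (m + 1), x < k ↔ x ≤ k' := fun x => by
    rw [Fin.lt_def, Fin.le_def]; omega
  set K := rowsIn π (j + 1) k d with hK
  have hKm : ∀ f, f ∈ K ↔ k ≤ f ∧ f < d ∧ j < π f := fun f => mem_rowsIn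
  -- Destinations are separated at row `k`. With the origin of row `k` replaced by the cell above
  -- it, the upper origins become exactly those of the entry in row `k'`, column `j`.
  have hD : dests π (π d) j = K.image π ∪ dests π (π k') j := by
    ext μ
    rw [mem_union, mem_image_perm, hKm, mem_dests, mem_dests, Equiv.symm_apply_apply,
      Equiv.symm_apply_apply, Equiv.apply_symm_apply]
    constructor
    · rintro ⟨h4, h5, h6⟩
      rcases lt_or_ge (π.symm μ) k with h7 | h7
      · exact Or.inr ⟨h4, h5, (hle _).1 h7⟩
      · refine Or.inl ⟨h7, lt_of_le_of_ne h6 ?_, lt_of_le_of_ne h4 ?_⟩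
        · intro h
          rw [← h, Equiv.apply_symm_apply] at hdj
          exact absurd hdj (not_lt.2 h4)
        · rintro rfl
          exact absurd h1 (not_lt.2 h7)
    · rintro (⟨h4, h5, h6⟩ | ⟨h4, h5, h6⟩)
      · exact ⟨h6.le, h1.le.trans h4, h5.le⟩
      · exact ⟨h4, h5, h6.trans (hlt.trans hkd).le⟩
  have hdisj : Disjoint (K.image π) (dests π (π k') j) := by
    refine disjoint_left.2 fun μ h4 h5 => ?_
    rw [mem_image_perm, hKm] at h4
    have h6 := (mem_dests.1 h5).2.2
    rw [Equiv.symm_apply_apply] at h6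
    exact absurd h4.1 (not_le.2 ((hle _).2 h6))
  have hjK : j ∉ K.image π := by
    rw [mem_image_perm, hKm]
    exact fun h => absurd h1 (not_lt.2 h.1)
  have hA : insert (lastCell k') ((origins π (π d) j).erase (lastCell k)) =
      ((insert d K).erase k).image lastCell ∪ origins π (π k') j := by
    rw [origins, origins, hD, erase_union_distrib, erase_eq_of_notMem hjK, image_union,
      image_gam (fun f hf => h2.le.trans ((hKm f).1 hf).1), gam_eq hd.le, gam_eq hR',
      ← insert_union, ← image_insert, erase_union_distrib, ← image_erase lastCell_injective,
      union_insert, erase_eq_of_notMem (s := ((dests π (π k') j).erase j).image (gam π))]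
    intro h
    obtain ⟨ν, hν, h4⟩ := mem_image.1 h
    have h5 : π.symm ν = k := congrArg Prod.fst h4
    have h6 := (mem_dests.1 (mem_of_mem_erase hν)).2.2
    rw [h5, Equiv.symm_apply_apply] at h6
    exact absurd hlt (not_lt.2 h6)
  have hB : (dests π (π d) j).image (one π) = ones π K ∪ (dests π (π k') j).image (one π) := by
    rw [hD, image_union, image_one_image]
  have hkK : k ∈ K := (hKm k).2 ⟨le_rfl, hkd, h3⟩
  have hU : ∀ x y : Cell m, x.1 < k → StepCut π k x y → y.1 < k := fun x y h4 h5 =>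
    h5.1.row_le.trans_lt h4
  have hAU : ∀ a ∈ origins π (π k') j, a.1 < k := fun a ha =>
    (hle _).2 (by simpa using origins_row_le ha)
  rw [hA, hB, pathSum_split F StepCut.step hU]
  rotate_left
  · intro a ha
    obtain ⟨f, hf, rfl⟩ := mem_image.1 ha
    rcases mem_insert.1 (mem_of_mem_erase hf) with rfl | hf
    · exact not_lt.2 hkd.le
    · exact not_lt.2 ((hKm f).1 hf).1
  · exact hAU
  · intro a ha
    obtain ⟨f, hf, rfl⟩ := mem_image.1 ha
    exact not_lt.2 ((hKm f).1 hf).1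
  · intro a ha
    obtain ⟨μ, hμ, rfl⟩ := mem_image.1 ha
    exact (hle (π.symm μ)).2 (by simpa using (mem_dests.1 hμ).2.2)
  · rw [card_ones, card_image_of_injective _ lastCell_injective,
      card_erase_of_mem (mem_insert_of_mem hkK), card_insert_of_notMem (by simp [hKm])]
    rfl
  -- All relevant steps below the separation start in rows `≥ k`, where the cuts at `k` and `0`
  -- agree; above it they start in rows `< k`, where the cut at `k` is no restriction.
  have hlow : pathSum F π (StepCut π k) (((insert d K).erase k).image lastCell) (ones π K) =
      pathSum F π (StepCut π 0) (((insert d K).erase k).image lastCell) (ones π K) := by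
    refine pathSum_congr_rel F fun a _ b hb x y _ hby hxy => ?_
    obtain ⟨f, hf, rfl⟩ := mem_image.1 hb
    have h4 : k ≤ x.1 := (((hKm f).1 hf).1.trans (Prod.le_def.1 hby).1).trans hxy.row_le
    have h4 := Fin.le_def.1 h4
    refine and_congr_right fun _ => not_congr (and_congr_right fun _ => and_congr_right fun _ => ?_)
    omega
  have hup : ∀ B', pathSum F π (StepCut π k) (origins π (π k') j) B' =
      pathSum F π (StepCut π (m + 1)) (origins π (π k') j) B' := by
    intro B'
    refine pathSum_congr_rel F fun a ha b _ x y hx _ hxy => ?_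
    have h4 : x.1 < k := (Prod.le_def.1 (reflTransGen_le StepCut.step hx)).1.trans_lt (hAU a ha)
    have h4 := Fin.lt_def.1 h4
    refine and_congr_right fun _ => not_congr (and_congr_right fun _ => and_congr_right fun _ => ?_)
    omega
  have hc : 1 ≤ (dests π (π k') j).card :=
    card_pos.2 ⟨j, mem_dests.2 ⟨le_rfl, le_rfl, by simpa using hj'⟩⟩
  obtain ⟨n, hn⟩ := Nat.exists_eq_add_of_le hc
  rw [jumpCoeff, wuAbove_eq F hk', wu_eq_R F (isNz_iff.2 ⟨hk'j, hj'⟩), R, Rgen, paths_eq, ← pathSum,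
    hlow, hup, hD, card_union_of_disjoint hdisj, prod_union hdisj,
    card_image_of_injective _ π.injective, prod_image (fun _ _ _ _ h => π.injective h), leftSum,
    ← hK, hn, wn_last, Nat.add_sub_cancel_left,
    show K.card + (1 + n) - 1 = K.card + n by omega, pow_add]
  ring

/-- The difference between the cuts at `d` and `0` telescopes over the rows `k < d`; only jump rows
contribute, each by `jump_term`. -/
theorem R1_eq {d j : Fin (m + 1)} (hd : π.symm (Fin.last m) < d) (hdj : π d < j) :
    R1 F π (π d) j = ∑ k ∈ (jumpRows π j).filter (fun k => k < d),
      jumpCoeff F π j k * leftSum F π (j + 1) k d := by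
  set A := origins π (π d) j with hA
  set B := (dests π (π d) j).image (one π) with hB
  set s : RatFun F π := (-1) ^ ((dests π (π d) j).card - 1) with hs
  set D : RatFun F π := ∏ μ ∈ dests π (π d) j, rho F π μ with hDD
  have key : ∀ n : ℕ, n ≤ d →
      s * (pathSum F π (StepCut π n) A B - pathSum F π (StepCut π 0) A B) / D =
      ∑ k ∈ (jumpRows π j).filter (fun k : Fin (m + 1) => (k : ℕ) < n),
        jumpCoeff F π j k * leftSum F π (j + 1) k d := by
    intro n
    induction n with
    | zero => intro _; simp
    | succ n ih =>
      intro hn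
      have hnm : n < m + 1 := by omega
      obtain ⟨k, rfl⟩ : ∃ k : Fin (m + 1), (k : ℕ) = n := ⟨⟨n, hnm⟩, rfl⟩
      have hkd : k < d := Fin.lt_def.2 (by omega)
      have ih := ih (by omega)
      by_cases hk : k ∈ jumpRows π j
      · obtain ⟨h1, h2, h3, k', hk', hk'j⟩ := mem_jumpRows.1 hk
        have hins : (jumpRows π j).filter (fun x : Fin (m + 1) => (x : ℕ) < k + 1) =
            insert k ((jumpRows π j).filter (fun x : Fin (m + 1) => (x : ℕ) < k)) := by
          ext x
          simp only [mem_filter, mem_insert]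
          constructor
          · rintro ⟨h4, h5⟩
            by_cases h6 : x = k
            · exact Or.inl h6
            · have : (x : ℕ) ≠ k := fun h => h6 (Fin.ext h)
              exact Or.inr ⟨h4, by omega⟩
          · rintro (rfl | ⟨h4, h5⟩)
            · exact ⟨hk, by omega⟩
            · exact ⟨h4, by omega⟩
        obtain ⟨h4, c, h5, h6, h7⟩ := (mem_jumpRows_iff hd hkd).1 hk
        have hc : c = lastCell k' := by
          obtain ⟨k'', rfl, h8, -⟩ := eq_of_step_lastCell h5 h6
          congr 1
          exact Fin.ext (by omega)
        subst hc
        rw [hins, sum_insert (by simp), ← jump_term F hd hkd hdj hk hk' hk'j, ← ih,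
          pathSum_stepCut_succ F h4, sum_eq_single (lastCell k')]
        · ring
        · intro c hc hne
          obtain ⟨-, h8, h9, h10⟩ := mem_filter.1 hc
          obtain ⟨k'', rfl, h11, -⟩ := eq_of_step_lastCell h8 h9
          exact (hne (congrArg lastCell (Fin.ext (by omega)))).elim
        · intro h
          exact (h (mem_filter.2 ⟨mem_univ _, h5, h6, h7⟩)).elim
      · have hins : (jumpRows π j).filter (fun x : Fin (m + 1) => (x : ℕ) < k + 1) =
            (jumpRows π j).filter (fun x : Fin (m + 1) => (x : ℕ) < k) := by
          refine filter_congr fun x hx => ?_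
          have : (x : ℕ) ≠ k := fun h => hk (by rwa [← Fin.ext h])
          omega
        rw [hins, ← ih]
        congr 3
        by_cases hkA : lastCell k ∈ A
        · rw [pathSum_stepCut_succ F hkA, sum_eq_zero, add_zero]
          intro c hc
          exact (hk ((mem_jumpRows_iff hd hkd).2 ⟨hkA, c, (mem_filter.1 hc).2⟩)).elim
        · rw [pathSum_stepCut_succ_of_notMem F hkA]
  rw [R1, Rgen, sum_paths1 F hd]
  exact key d le_rfl

end BottomLeft

/-! ### Laurent polynomials -/

section Laurent

variable (F : Type*) [Field F] {m : ℕ} (π : Equiv.Perm (Fin (m + 1)))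

theorem nvar_mem_laurent (a b : Fin (m + 1)) : nvar F π a b ∈ laurent F π := by
  by_cases h : (a, b) ∈ Inv π
  · exact Subring.subset_closure ⟨(a, b), h, Or.inl rfl⟩
  · rw [nvar, dif_neg h]
    split_ifs
    · exact one_mem _
    · exact zero_mem _

theorem nvar_inv_mem_laurent (a b : Fin (m + 1)) : (nvar F π a b)⁻¹ ∈ laurent F π := by
  by_cases h : (a, b) ∈ Inv π
  · exact Subring.subset_closure ⟨(a, b), h, Or.inr rfl⟩
  · rw [nvar, dif_neg h]
    split_ifs
    · rw [inv_one]
      exact one_mem _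
    · rw [inv_zero]
      exact zero_mem _

/-- All denominators are products of nonzero entries, hence monomials in the free variables. -/
theorem rho_inv_mem_laurent (μ : Fin (m + 1)) : (rho F π μ)⁻¹ ∈ laurent F π := by
  rw [rho, ← prod_inv_distrib]
  exact prod_mem fun b _ => nvar_inv_mem_laurent F π _ _

theorem prod_rho_inv_mem_laurent (D : Finset (Fin (m + 1))) :
    (∏ μ ∈ D, rho F π μ)⁻¹ ∈ laurent F π := by
  rw [← prod_inv_distrib]
  exact prod_mem fun μ _ => rho_inv_mem_laurent F π μ

variable {π} in
theorem weight_mem_laurent (P : Finset (Path π)) : weight F P ∈ laurent F π := by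
  refine prod_mem fun p _ => list_prod_mem fun x hx => ?_
  obtain ⟨c, -, rfl⟩ := List.mem_map.1 hx
  exact nvar_mem_laurent F π _ _

theorem neg_one_pow_mem_laurent (n : ℕ) : (-1 : RatFun F π) ^ n ∈ laurent F π :=
  pow_mem (neg_mem (one_mem _)) n

theorem Rgen_mem_laurent (C : Finset (Finset (Path π))) (a b : Fin (m + 1)) :
    Rgen F π C a b ∈ laurent F π := by
  rw [Rgen, div_eq_mul_inv]
  exact mul_mem (mul_mem (neg_one_pow_mem_laurent F π _)
    (sum_mem fun P _ => weight_mem_laurent F P)) (prod_rho_inv_mem_laurent F π _)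

theorem wu_mem_laurent (k b : Fin (m + 1)) : wu F π k b ∈ laurent F π := by
  rw [wu, Matrix.of_apply]
  split_ifs
  · exact Rgen_mem_laurent F π _ _ _
  · exact nvar_mem_laurent F π _ _

theorem wuAbove_mem_laurent (k b : Fin (m + 1)) : wuAbove F π k b ∈ laurent F π := by
  rw [wuAbove]
  split_ifs
  · exact zero_mem _
  · exact wu_mem_laurent F π _ _

theorem PLstar_mem_laurent (A B : Finset (Cell m)) : PLstar F π A B ∈ laurent F π := by
  rw [PLstar]
  split_ifs
  · exact one_mem _
  · exact sum_mem fun P _ => weight_mem_laurent F P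

theorem Q_mem_laurent (j l : Fin (m + 1)) : Q F π j l ∈ laurent F π := by
  refine sum_mem fun ν _ => mul_mem (mul_mem (mul_mem (neg_one_pow_mem_laurent F π _)
    (nvar_mem_laurent F π _ _)) (wuAbove_mem_laurent F π _ _)) ?_
  rw [div_eq_mul_inv]
  exact mul_mem (PLstar_mem_laurent F π _ _) (prod_rho_inv_mem_laurent F π _)

end Laurent

/-! ### The four types of entries -/

section Types

open scoped Classical

variable (F : Type*) [Field F] {m : ℕ} {π : Equiv.Perm (Fin (m + 1))}

theorem nvar_eq_zero_of_lt {k : Fin (m + 1)} (h : k < π.symm (Fin.last m)) :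
    nvar F π (π k) (Fin.last m) = 0 :=
  wn_of_not_nz F fun h' => absurd h (not_lt.2 (isNz_last.1 h'))

/-- Rows above `1_r` are zero in the rightmost column, so no origin lies there and the left-start
condition is vacuous. -/
theorem pathsL_eq_paths_of_lt {d j : Fin (m + 1)} (h : d < π.symm (Fin.last m))
    (B : Finset (Cell m)) :
    pathsL π (origins π (π d) j) B = paths π (origins π (π d) j) B := by
  refine filter_true_of_mem fun P hP p hp _ hlast => ?_
  have hA := (mem_filter.1 hP).2.1
  have h1 : p.origin.1 ≤ d := by
    have h3 := origins_row_le (hA ▸ mem_image_of_mem Path.origin hp)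
    rwa [Equiv.symm_apply_apply] at h3
  have h2 : IsNz π (p.origin.1, Fin.last m) := hlast ▸ p.2.2.1 _ p.origin_mem
  exact absurd h (not_lt.2 ((isNz_last.1 h2).trans h1))

theorem RL_eq_R_of_lt {d j : Fin (m + 1)} (h : d < π.symm (Fin.last m)) :
    RL F π (π d) j = R F π (π d) j := by
  rw [RL, R, pathsL_eq_paths_of_lt h]

theorem R1_eq_zero_of_lt {d j : Fin (m + 1)} (h : d < π.symm (Fin.last m)) :
    R1 F π (π d) j = 0 := by
  rw [R1, Rgen, paths1, pathsL_eq_paths_of_lt h]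
  simp

theorem xPrime_and_xL_eq_wu {d j : Fin (m + 1)} (h : d ≤ π.symm j ∨ d < π.symm (Fin.last m)) :
    xPrime F π d j = wu F π d j ∧ xL F π d j = wu F π d j := by
  by_cases hf : IsFree π (d, j)
  · have hd : d < π.symm (Fin.last m) :=
      h.resolve_left (not_le.2 (isFree_iff.1 hf).2)
    rw [xPrime, if_pos hf, xL, if_pos hf, RL_eq_R_of_lt F hd, R1_eq_zero_of_lt F hd, wu,
      Matrix.of_apply, if_pos hf, add_zero]
    exact ⟨rfl, rfl⟩
  · rw [xPrime, if_neg hf, xL, if_neg hf]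
    refine ⟨?_, rfl⟩
    split_ifs with h0
    · obtain ⟨h1, h2⟩ := h0
      rcases h with h | h
      · exfalso
        rcases h.eq_or_lt with rfl | h
        · have := wu_one F (π := π) (π.symm j)
          rw [Equiv.apply_symm_apply, h1] at this
          exact zero_ne_one this
        -- Above row `π⁻¹ j` column `j` is zero, so the entry above is zero as well and the special
        -- case of `x'` cannot occur.
        · refine h2 ?_
          rw [wuAbove]
          split_ifs with h3
          · rfl
          · refine wu_of_not_nz F fun h4 => ?_
            have h5 := Fin.le_def.1 (isNz_iff.1 h4).2
            have h6 := Fin.lt_def.1 h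
            simp only at h5
            omega
      · rw [nvar_eq_zero_of_lt F h, h1, neg_zero, zero_mul]
    · rfl

theorem sum_Q_mul_xL_eq_zero {d j : Fin (m + 1)} (hj : π (Fin.last m) < j) (hl : j < Fin.last m)
    (h : d ≤ π.symm j ∨ d < π.symm (Fin.last m)) :
    ∑ l ∈ Ioo j (Fin.last m), Q F π j l * xL F π d l = 0 := by
  rw [sum_Q_mul_xL F hj hl]
  refine sum_eq_zero fun k hk => ?_
  obtain ⟨h1, h2, -⟩ := mem_jumpRows.1 hk
  rw [sum_eq_zero, mul_zero]
  intro e he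
  have h3 := (mem_filter.1 he).2.1
  rw [xL_of_not_nz, mul_zero]
  intro h4
  have h5 : e ≤ d := by simpa using (isNz_iff.1 h4).2
  rcases h with h | h
  · exact absurd (h1.trans_le h3) (not_lt.2 (h5.trans h))
  · exact absurd (h2.trans_le h3) (not_lt.2 (h5.trans h.le))

theorem R1_add_sum {d j : Fin (m + 1)} (hj : π (Fin.last m) < j) (hl : j < Fin.last m)
    (hd : π.symm (Fin.last m) < d) (hdj : π d < j) :
    R1 F π (π d) j + ∑ l ∈ Ioo j (Fin.last m), Q F π j l * xL F π d l = 0 := by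
  rw [sum_Q_mul_xL F hj hl, R1_eq F hd hdj, sum_filter, ← sum_add_distrib]
  refine sum_eq_zero fun k hk => ?_
  rw [sum_leftSum_mul_xL_of_lt F (mem_jumpRows.1 hk).2.1 hdj]
  split_ifs <;> ring

theorem sum_Q_mul_xL_of_gt {d j : Fin (m + 1)} (hj : π (Fin.last m) < j) (hl : j < Fin.last m)
    (hdj : j < π d) :
    ∑ l ∈ Ioo j (Fin.last m), Q F π j l * xL F π d l =
      if d ∈ jumpRows π j then jumpCoeff F π j d else 0 := by
  rw [sum_Q_mul_xL F hj hl, sum_congr rfl fun k hk => by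
    rw [sum_leftSum_mul_xL_of_gt F (mem_jumpRows.1 hk).2.1 hdj, mul_ite, mul_one, mul_zero]]
  rw [sum_ite_eq']

/-- The case distinction in `x'` is immaterial here: if the entry above is zero, the product is zero
too. -/
theorem xPrime_of_gt {d d' j : Fin (m + 1)} (hd' : (d' : ℕ) + 1 = d) (hdj : j < π d) :
    xPrime F π d j = -nvar F π (π d) (Fin.last m) * wu F π d' j ∧ xL F π d j = 0 := by
  have hnz : ¬ IsNz π (d, j) := fun h => absurd hdj (not_lt.2 (isNz_iff.1 h).1)
  refine ⟨?_, xL_of_not_nz F hnz⟩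
  rw [xPrime, if_neg (fun h => hnz (Or.inr h)), wuAbove_eq F hd', wu_of_not_nz F hnz]
  split_ifs with h
  · rfl
  · have : wu F π d' j = 0 := by
      by_contra h'
      exact h ⟨rfl, h'⟩
    rw [this, mul_zero]

theorem column_identities {d j : Fin (m + 1)} (hj : π (Fin.last m) < j) (hl : j < Fin.last m)
    (hd : d ≠ π.symm (Fin.last m)) :
    xPrime F π d j + ∑ l ∈ Ioo j (Fin.last m), Q F π j l * xL F π d l = xL F π d j ∧
      (d ≤ π.symm j ∨ d < π.symm (Fin.last m) →
        xPrime F π d j = wu F π d j ∧ xL F π d j = wu F π d j ∧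
        ∑ l ∈ Ioo j (Fin.last m), Q F π j l * xL F π d l = 0) ∧
      (π.symm j < d → π.symm (Fin.last m) < d → π d < j →
        xPrime F π d j = RL F π (π d) j + R1 F π (π d) j ∧
        xL F π d j = RL F π (π d) j ∧
        R1 F π (π d) j + ∑ l ∈ Ioo j (Fin.last m), Q F π j l * xL F π d l = 0) ∧
      (∀ d' : Fin (m + 1), (d' : ℕ) + 1 = d →
        π.symm j < d → π.symm (Fin.last m) < d → π d' ≤ j → j < π d →
        xPrime F π d j = -nvar F π (π d) (Fin.last m) * wu F π d' j ∧
        xL F π d j = 0 ∧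
        -nvar F π (π d) (Fin.last m) * wu F π d' j +
          ∑ l ∈ Ioo j (Fin.last m), Q F π j l * xL F π d l = 0) ∧
      (∀ d' : Fin (m + 1), (d' : ℕ) + 1 = d →
        π.symm j < d → π.symm (Fin.last m) < d → j < π d' → j < π d →
        xPrime F π d j = 0 ∧ xL F π d j = 0 ∧
        ∑ l ∈ Ioo j (Fin.last m), Q F π j l * xL F π d l = 0) := by
  have t₁ : d ≤ π.symm j ∨ d < π.symm (Fin.last m) →
        xPrime F π d j = wu F π d j ∧ xL F π d j = wu F π d j ∧
        ∑ l ∈ Ioo j (Fin.last m), Q F π j l * xL F π d l = 0 := fun h =>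
    ⟨(xPrime_and_xL_eq_wu F h).1, (xPrime_and_xL_eq_wu F h).2, sum_Q_mul_xL_eq_zero F hj hl h⟩
  have t₂ : π.symm j < d → π.symm (Fin.last m) < d → π d < j →
        xPrime F π d j = RL F π (π d) j + R1 F π (π d) j ∧
        xL F π d j = RL F π (π d) j ∧
        R1 F π (π d) j + ∑ l ∈ Ioo j (Fin.last m), Q F π j l * xL F π d l = 0 := by
    intro h1 h2 h3
    have hf : IsFree π (d, j) := isFree_iff.2 ⟨h3, h1⟩
    exact ⟨by rw [xPrime, if_pos hf], by rw [xL, if_pos hf], R1_add_sum F hj hl h2 h3⟩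
  have t₃ : ∀ d' : Fin (m + 1), (d' : ℕ) + 1 = d →
        π.symm j < d → π.symm (Fin.last m) < d → π d' ≤ j → j < π d →
        xPrime F π d j = -nvar F π (π d) (Fin.last m) * wu F π d' j ∧
        xL F π d j = 0 ∧
        -nvar F π (π d) (Fin.last m) * wu F π d' j +
          ∑ l ∈ Ioo j (Fin.last m), Q F π j l * xL F π d l = 0 := by
    intro d' hd' h1 h2 h3 h4
    refine ⟨(xPrime_of_gt F hd' h4).1, (xPrime_of_gt F hd' h4).2, ?_⟩
    rw [sum_Q_mul_xL_of_gt F hj hl h4, if_pos (mem_jumpRows.2 ⟨h1, h2, h4, d', hd', h3⟩),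
      jumpCoeff, wuAbove_eq F hd']
    ring
  have t₄ : ∀ d' : Fin (m + 1), (d' : ℕ) + 1 = d →
        π.symm j < d → π.symm (Fin.last m) < d → j < π d' → j < π d →
        xPrime F π d j = 0 ∧ xL F π d j = 0 ∧
        ∑ l ∈ Ioo j (Fin.last m), Q F π j l * xL F π d l = 0 := by
    intro d' hd' h1 h2 h3 h4
    have h5 : wu F π d' j = 0 :=
      wu_of_not_nz F fun h => absurd h3 (not_lt.2 (isNz_iff.1 h).1)
    refine ⟨by rw [(xPrime_of_gt F hd' h4).1, h5, mul_zero], (xPrime_of_gt F hd' h4).2, ?_⟩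
    rw [sum_Q_mul_xL_of_gt F hj hl h4, if_neg]
    rintro h
    obtain ⟨-, -, -, k', hk', h6⟩ := mem_jumpRows.1 h
    have : k' = d' := Fin.ext (by omega)
    exact absurd h3 (not_lt.2 (this ▸ h6))
  refine ⟨?_, t₁, t₂, t₃, t₄⟩
  by_cases h : d ≤ π.symm j ∨ d < π.symm (Fin.last m)
  · obtain ⟨h1, h2, h3⟩ := t₁ h
    rw [h1, h2, h3, add_zero]
  · rw [not_or, not_le, not_lt] at h
    have h2 : π.symm (Fin.last m) < d := lt_of_le_of_ne h.2 hd.symm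
    rcases lt_trichotomy (π d) j with hdj | rfl | hdj
    · obtain ⟨h4, h5, h6⟩ := t₂ h.1 h2 hdj
      rw [h4, h5, add_assoc, h6, add_zero]
    · exact absurd h.1 (by simp)
    · obtain ⟨d', hd'⟩ : ∃ d' : Fin (m + 1), (d' : ℕ) + 1 = d := by
        have := Fin.lt_def.1 h2
        exact ⟨⟨d - 1, by omega⟩, by simp only; omega⟩
      rcases le_or_gt (π d') j with h3 | h3
      · obtain ⟨h4, h5, h6⟩ := t₃ d' hd' h.1 h2 h3 hdj
        rw [h4, h5, h6]
      · obtain ⟨h4, h5, h6⟩ := t₄ d' hd' h.1 h2 h3 hdj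
        rw [h4, h5, h6, add_zero]

end Types

/-! ### The matrix of the column operations -/

section ColumnMatrix

/-- A unipotent matrix `1 - N` with `N` strictly lower triangular over a subring has a lower
unitriangular inverse over that subring. -/
theorem exists_inverse_one_sub {K : Type*} [Field K] (S : Subring K) {n : ℕ}
    (N : Matrix (Fin n) (Fin n) K) (hN : ∀ p q, p ≤ q → N p q = 0) (hS : ∀ p q, N p q ∈ S) :
    ∃ M : Matrix (Fin n) (Fin n) K, (∀ p q, p < q → M p q = 0) ∧ (∀ p, M p p = 1) ∧
      (∀ p q, M p q ∈ S) ∧ M * (1 - N) = 1 := by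
  have hdet : (1 - N).det = 1 := by
    rw [Matrix.det_of_isLowerTriangular]
    · refine prod_eq_one fun p _ => ?_
      simp [hN p p le_rfl]
    · intro p q hpq
      have hpq : p < q := hpq
      simp [hN p q hpq.le, hpq.ne]
  have hunit : IsUnit (1 - N).det := by rw [hdet]; exact isUnit_one
  have hM := Matrix.nonsing_inv_mul _ hunit
  set M := (1 - N)⁻¹
  -- The relation `M = 1 + M N` expresses a column of `M` through columns further right only, so
  -- triangularity and membership in `S` follow by induction starting from the last column.
  have hrec : ∀ p q, M p q = (1 : Matrix (Fin n) (Fin n) K) p q + ∑ s, M p s * N s q := by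
    intro p q
    rw [← Matrix.mul_apply, ← Matrix.add_apply]
    rw [mul_sub, mul_one, sub_eq_iff_eq_add] at hM
    exact congrFun (congrFun hM p) q
  have hz : ∀ t : ℕ, ∀ p q : Fin n, n - q = t → p < q → M p q = 0 := by
    intro t
    induction t using Nat.strong_induction_on with
    | _ t ih =>
    intro p q hq hpq
    rw [hrec, Matrix.one_apply_ne hpq.ne, zero_add]
    refine sum_eq_zero fun s _ => ?_
    rcases le_or_gt s q with h | h
    · rw [hN s q h, mul_zero]
    · rw [ih (n - s) (by have := Fin.lt_def.1 h; omega) p s rfl (hpq.trans h), zero_mul]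
  have hL : ∀ t : ℕ, ∀ p q : Fin n, n - q = t → M p q ∈ S := by
    intro t
    induction t using Nat.strong_induction_on with
    | _ t ih =>
    intro p q hq
    rw [hrec]
    refine add_mem ?_ (sum_mem fun s _ => ?_)
    · rw [Matrix.one_apply]
      split_ifs
      · exact one_mem _
      · exact zero_mem _
    · rcases le_or_gt s q with h | h
      · rw [hN s q h, mul_zero]
        exact zero_mem _
      · exact mul_mem (ih (n - s) (by have := Fin.lt_def.1 h; omega) p s rfl) (hS s q)
  refine ⟨M, fun p q => hz _ p q rfl, fun p => ?_, fun p q => hL _ p q rfl, hM⟩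
  rw [hrec, Matrix.one_apply_eq, sum_eq_zero, add_zero]
  intro s _
  rcases le_or_gt s p with h | h
  · rw [hN s p h, mul_zero]
  · rw [hz _ p s rfl h, zero_mul]

variable (F : Type*) [Field F] {m : ℕ} {π : Equiv.Perm (Fin (m + 1))}

theorem val_col {i : ℕ} (hi : i ≤ m + 1) (q : Fin (i - 1)) :
    (col m i q : ℕ) = m + 1 - i + q := by
  have := q.2
  rw [col, Fin.val_ofNat, Nat.mod_eq_of_lt]
  omega

theorem sum_Ioo_col {i : ℕ} (hi : i ≤ m + 1) (q : Fin (i - 1)) (f : Fin (m + 1) → RatFun F π) :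
    ∑ l ∈ Ioo (col m i q) (Fin.last m), f l = ∑ p, if q < p then f (col m i p) else 0 := by
  rw [← sum_filter]
  symm
  refine sum_bij (fun p _ => col m i p) ?_ ?_ ?_ ?_
  · intro p hp
    have h1 := Fin.lt_def.1 (mem_filter.1 hp).2
    have h2 := p.2
    refine mem_Ioo.2 ⟨Fin.lt_def.2 ?_, Fin.lt_def.2 ?_⟩
    · rw [val_col hi, val_col hi]; omega
    · rw [val_col hi, Fin.val_last]; omega
  · intro p _ p' _ h
    have := congrArg Fin.val h
    rw [val_col hi, val_col hi] at this
    exact Fin.ext (by omega)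
  · intro l hl
    obtain ⟨h1, h2⟩ := mem_Ioo.1 hl
    have h1 := Fin.lt_def.1 h1
    have h2 := Fin.lt_def.1 h2
    rw [val_col hi] at h1
    rw [Fin.val_last] at h2
    have h3 : (l : ℕ) - (m + 1 - i) < i - 1 := by omega
    refine ⟨⟨l - (m + 1 - i), h3⟩, mem_filter.2 ⟨mem_univ _, Fin.lt_def.2 ?_⟩, Fin.ext ?_⟩
    · simp only; omega
    · rw [val_col hi]; simp only; omega
  · intro p _
    rfl

/-- The same right factor serves every choice of rows avoiding the row of `1_r`, which is why one
matrix handles `T` and `F` simultaneously. -/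
theorem rows_eq_mul {i : ℕ} (hi : i ≤ m + 1)
    (hπ : ((π (Fin.last m) : Fin (m + 1)) : ℕ) + 1 < m + 1 - i + 1)
    (row : Fin (i - 1) → Fin (m + 1)) (hrow : ∀ p, row p ≠ π.symm (Fin.last m)) :
    Matrix.of (fun p q => xPrime F π (row p) (col m i q)) =
      Matrix.of (fun p q => xL F π (row p) (col m i q)) * (1 - Qmat π F i) := by
  ext p q
  have hq := val_col hi q
  have hqlt := q.2
  have hj : π (Fin.last m) < col m i q := Fin.lt_def.2 (by omega)
  have hl : col m i q < Fin.last m := Fin.lt_def.2 (by rw [Fin.val_last]; omega)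
  have h := (column_identities F hj hl (hrow p)).1
  rw [sum_Ioo_col F hi] at h
  rw [mul_sub, mul_one, Matrix.sub_apply, Matrix.mul_apply, Matrix.of_apply, Matrix.of_apply,
    eq_sub_iff_add_eq, ← h]
  congr 1
  refine sum_congr rfl fun s _ => ?_
  rw [Matrix.of_apply, Qmat, Matrix.of_apply]
  split_ifs <;> ring

theorem rowT_ne {i : ℕ} (hi : i ≤ m + 1) (p : Fin (i - 1)) :
    rowT π i p ≠ π.symm (Fin.last m) := by
  intro h
  have h := congrArg Fin.val h
  have hp := p.2
  rw [rowT, Fin.val_ofNat, Nat.mod_eq_of_lt] at h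
  · change _ = rowOne π at h
    split_ifs at h <;> omega
  · split_ifs <;> omega

theorem rowF_ne {i : ℕ} (hi : i ≤ m) (p : Fin (i - 1)) :
    rowF π i p ≠ π.symm (Fin.last m) := by
  intro h
  have h := congrArg Fin.val h
  have hp := p.2
  rw [rowF, Fin.val_ofNat, Nat.mod_eq_of_lt] at h
  · change _ = rowOne π at h
    split_ifs at h <;> omega
  · split_ifs <;> omega

end ColumnMatrix

end

end ColOp

theorem mainTheorem3 (F : Type*) [Field F] [CharZero F] (m : ℕ) (π : Equiv.Perm (Fin (m + 1)))
    (i : ℕ) (hi1 : 1 ≤ i) (hir : i ≤ m + 1)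
    (hπ : ((π (Fin.last m) : Fin (m + 1)) : ℕ) + 1 < m + 1 - i + 1) :
    -- the coefficients `Q_j(l)` are Laurent polynomials
    (∀ j l : Fin (m + 1), m + 1 - i ≤ (j : ℕ) → j < l → l < Fin.last m →
      ColOp.Q F π j l ∈ ColOp.laurent F π) ∧
    -- the defining identity, and what it says for each of the four types of entries
    (∀ d j : Fin (m + 1), m + 1 - i ≤ (d : ℕ) + 1 → d ≠ π.symm (Fin.last m) →
      m + 1 - i ≤ (j : ℕ) → j < Fin.last m →
      ColOp.xPrime F π d j +
          ∑ l ∈ Finset.Ioo j (Fin.last m), ColOp.Q F π j l * ColOp.xL F π d l =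
        ColOp.xL F π d j ∧
      (d ≤ π.symm j ∨ d < π.symm (Fin.last m) →
        ColOp.xPrime F π d j = ColOp.wu F π d j ∧ ColOp.xL F π d j = ColOp.wu F π d j ∧
        ∑ l ∈ Finset.Ioo j (Fin.last m), ColOp.Q F π j l * ColOp.xL F π d l = 0) ∧
      (π.symm j < d → π.symm (Fin.last m) < d → π d < j →
        ColOp.xPrime F π d j = ColOp.RL F π (π d) j + ColOp.R1 F π (π d) j ∧
        ColOp.xL F π d j = ColOp.RL F π (π d) j ∧
        ColOp.R1 F π (π d) j +
          ∑ l ∈ Finset.Ioo j (Fin.last m), ColOp.Q F π j l * ColOp.xL F π d l = 0) ∧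
      (∀ d' : Fin (m + 1), (d' : ℕ) + 1 = d →
        π.symm j < d → π.symm (Fin.last m) < d → π d' ≤ j → j < π d →
        ColOp.xPrime F π d j = -ColOp.nvar F π (π d) (Fin.last m) * ColOp.wu F π d' j ∧
        ColOp.xL F π d j = 0 ∧
        -ColOp.nvar F π (π d) (Fin.last m) * ColOp.wu F π d' j +
          ∑ l ∈ Finset.Ioo j (Fin.last m), ColOp.Q F π j l * ColOp.xL F π d l = 0) ∧
      (∀ d' : Fin (m + 1), (d' : ℕ) + 1 = d →
        π.symm j < d → π.symm (Fin.last m) < d → j < π d' → j < π d →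
        ColOp.xPrime F π d j = 0 ∧ ColOp.xL F π d j = 0 ∧
        ∑ l ∈ Finset.Ioo j (Fin.last m), ColOp.Q F π j l * ColOp.xL F π d l = 0)) ∧
    -- the lower unitriangular matrix of the column operations
    ∃ M : Matrix (Fin (i - 1)) (Fin (i - 1)) (ColOp.RatFun F π),
      (∀ p q, p < q → M p q = 0) ∧ (∀ p, M p p = 1) ∧
      (∀ p q, M p q ∈ ColOp.laurent F π) ∧
      M * (1 - ColOp.Qmat π F i) = 1 ∧
      ColOp.TPrime π F i * M = ColOp.TL π F i ∧
      ColOp.FPrime π F i * M = ColOp.FL π F i := by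
  -- Since `π (Fin.last m)` is at least `0`, the bound `hπ` excludes `i = m + 1`. The subtraction `m
  -- + 1 - i - 1` in `rowF` is then not truncated.
  have hi : i ≤ m := by omega
  refine ⟨fun j l _ _ _ => ColOp.Q_mem_laurent F π j l, fun d j _ hd hj hjl =>
    ColOp.column_identities F (Fin.lt_def.2 (by omega)) hjl hd, ?_⟩
  obtain ⟨M, h₁, h₂, h₃, h₄⟩ := ColOp.exists_inverse_one_sub (ColOp.laurent F π)
    (ColOp.Qmat π F i)
    (fun p q hpq => by rw [ColOp.Qmat, Matrix.of_apply, if_neg (not_lt.2 hpq)])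
    (fun p q => by
      rw [ColOp.Qmat, Matrix.of_apply]
      split_ifs
      · exact ColOp.Q_mem_laurent F π _ _
      · exact zero_mem _)
  refine ⟨M, h₁, h₂, h₃, h₄, ?_, ?_⟩
  · rw [ColOp.TPrime, ColOp.TL, ColOp.rows_eq_mul F hir hπ _ (ColOp.rowT_ne hir), mul_assoc,
      mul_eq_one_comm.1 h₄, mul_one]
  · rw [ColOp.FPrime, ColOp.FL, ColOp.rows_eq_mul F hir hπ _ (ColOp.rowF_ne hi), mul_assoc,
      mul_eq_one_comm.1 h₄, mul_one]
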